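/- Let $0<\delta<\pi$, $0<\sigma<\pi/\delta$, let $\nu$ be a symmetric Borel probability measure on $[-\sigma/2,\sigma/2]$, let $n\ge 2$ be an integer, and put $\gamma=\cos(\sigma\delta/2)$ and $r=n^{5/6}$. The Fourier transform is normalized as $\hat f(\xi)=\frac1{\sqrt{2\pi}}\int_{\mathbb R}f(t)e^{-it\xi}\,dt$ (extended to $L^2(\mathbb R)$), and $\mathcal B_\delta(\mathbb R)$ denotes the space of all $f\in L^2(\mathbb R)\cap C(\mathbb R)$ with $\operatorname{supp}\hat f\subseteq[-\delta,\delta]$. For $f\in\mathcal B_\delta(\mathbb R)$ and $j\in\mathbb Z$ let $\tilde f(j)=\int_{[-\sigma/2,\sigma/2]}f(j+x)\,d\nu(x)$, and let $W(\xi)=\int_{[-\sigma/2,\sigma/2]}e^{it\xi}\,d\nu(t)$. Let $\phi(t)=\frac1{\sqrt{2\pi}}\int_{\mathbb R}\hat\phi(\xi)e^{it\xi}\,d\xi$, where $$\hat\phi(\xi)=\begin{cases}\dfrac1{W(\xi)}, & |\xi|\le\delta,\\[2mm] \left[\dfrac{|\xi|-(2\pi-\delta)}{2\pi-2\delta}\right]^2P(\xi),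 & \delta\le|\xi|\le2\pi-\delta,\\[2mm] 0, & |\xi|>2\pi-\delta,\end{cases}$$ $$P(\xi)=\left(\frac1{(\pi-\delta)W(\delta)}-\frac{W'(\delta)}{W(\delta)^2}\right)|\xi|+\frac{\pi-2\delta}{(\pi-\delta)W(\delta)}+\frac{\delta W'(\delta)}{W(\delta)^2},$$ and define the Gaussian regularized average sampling series $$(\mathbf S_{n,r}f)(t)=\frac1{\sqrt{2\pi}}\sum_{j=-n+1}^{n}\tilde f(j)\,\phi(t-j)\,e^{-\frac{(t-j)^2}{2r^2}},\qquad t\in(0,1).$$ Then $$\sup_{f\in\mathcal B_\delta(\mathbb R),\ \|f\|_{L^2(\mathbb R)}\le1}\|f-\mathbf S_{n,r}f\|_{L^\infty((0,1))}\le c\,n^{-5/3},$$ where $$c=\frac{(\sqrt\delta+2\delta)\sigma^2}{\gamma^3}+\left(\frac{4\sigma\sqrt\delta}{(\pi-\delta)^2}+\frac{16\sigma}{\pi-\delta}+\pi\sigma\sqrt\delta\right)\frac1{\gamma^2}+\left(\frac{8\sqrt\delta}{(\pi-\delta)^2}+\frac{32}{\pi-\delta}+10\sqrt\delta\right)\frac1{(\pi-\delta)\gamma}.$$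 -/

import Mathlib

open MeasureTheory
open scoped FourierTransform ENNReal

namespace AverageSampling

noncomputable section

/-- The Fourier–Plancherel transform on `L²(ℝ)` in the normalization
`f̂(ξ) = (2π)^{-1/2} ∫ f(t) e^{-itξ} dt`, obtained by rescaling Mathlib's transform, whose kernel
is `e^{-2πi t η}` (so that `η = ξ / 2π`). It is determined up to null sets. -/
def plancherel (f : ℝ → ℂ) (hf : MemLp f 2 (volume : Measure ℝ)) : ℝ → ℂ :=
  fun ξ => ((Real.sqrt (2 * Real.pi))⁻¹ : ℂ) *
    (𝓕 (hf.toLp f : Lp ℂ 2 (volume : Measure ℝ)) : Lp ℂ 2 (volume : Measure ℝ))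
      (ξ / (2 * Real.pi))

/-- The Paley–Wiener space `𝓑_δ(ℝ)`: continuous square-integrable functions whose Fourier
transform is supported in `[-δ, δ]`. -/
def PaleyWiener (δ : ℝ) : Set (ℝ → ℂ) :=
  {f | Continuous f ∧ ∃ hf : MemLp f 2 (volume : Measure ℝ),
    ∀ᵐ ξ : ℝ, ξ ∉ Set.Icc (-δ) δ → plancherel f hf ξ = 0}

/-- The average samples `f̃(j) = ∫_{[-σ/2, σ/2]} f(j + x) dν(x)`. -/
def averageSample (ν : Measure ℝ) (σ : ℝ) (f : ℝ → ℂ) (j : ℤ) : ℂ :=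
  ∫ x in Set.Icc (-(σ / 2)) (σ / 2), f ((j : ℝ) + x) ∂ν

/-- `W(ξ) = ∫_{[-σ/2, σ/2]} e^{itξ} dν(t)`. -/
def W (ν : Measure ℝ) (σ : ℝ) (ξ : ℝ) : ℂ :=
  ∫ t in Set.Icc (-(σ / 2)) (σ / 2), Complex.exp (Complex.I * (t : ℂ) * (ξ : ℂ)) ∂ν

/-- The affine function of `|ξ|` used to extend `1 / W` beyond `[-δ, δ]`. -/
def P (ν : Measure ℝ) (σ δ : ℝ) (ξ : ℝ) : ℂ :=
  (1 / (((Real.pi - δ : ℝ) : ℂ) * W ν σ δ) - deriv (W ν σ) δ / (W ν σ δ) ^ 2) * ((|ξ| : ℝ) : ℂ)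
    + ((Real.pi - 2 * δ : ℝ) : ℂ) / (((Real.pi - δ : ℝ) : ℂ) * W ν σ δ)
    + (δ : ℂ) * deriv (W ν σ) δ / (W ν σ δ) ^ 2

/-- The Fourier transform `φ̂` of the reconstruction function. -/
def phiHat (ν : Measure ℝ) (σ δ : ℝ) (ξ : ℝ) : ℂ :=
  if |ξ| ≤ δ then 1 / W ν σ ξ
  else if |ξ| ≤ 2 * Real.pi - δ then
    ((((|ξ| - (2 * Real.pi - δ)) / (2 * Real.pi - 2 * δ)) ^ 2 : ℝ) : ℂ) * P ν σ δ ξ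
  else 0

/-- The reconstruction function `φ(t) = (2π)^{-1/2} ∫ φ̂(ξ) e^{itξ} dξ`. -/
def phi (ν : Measure ℝ) (σ δ : ℝ) (t : ℝ) : ℂ :=
  ((Real.sqrt (2 * Real.pi))⁻¹ : ℂ) *
    ∫ ξ : ℝ, phiHat ν σ δ ξ * Complex.exp (Complex.I * (t : ℂ) * (ξ : ℂ))

/-- The Gaussian regularized average sampling series
`(S_{n,r} f)(t) = (2π)^{-1/2} ∑_{-n < j ≤ n} f̃(j) φ(t - j) e^{-(t - j)² / (2 r²)}`. -/
def gaussianSeries (ν : Measure ℝ) (σ δ : ℝ) (n : ℕ) (r : ℝ) (f : ℝ → ℂ) (t : ℝ) : ℂ :=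
  ((Real.sqrt (2 * Real.pi))⁻¹ : ℂ) *
    ∑ j ∈ Finset.Ioc (-(n : ℤ)) (n : ℤ),
      averageSample ν σ f j * phi ν σ δ (t - (j : ℝ)) *
        ((Real.exp (-(t - (j : ℝ)) ^ 2 / (2 * r ^ 2)) : ℝ) : ℂ)

/-- The constant in the error estimate, where `γ` stands for `cos (σ δ / 2)`. -/
def errorConstant (δ σ γ : ℝ) : ℝ :=
  (Real.sqrt δ + 2 * δ) * σ ^ 2 / γ ^ 3
    + (4 * σ * Real.sqrt δ / (Real.pi - δ) ^ 2 + 16 * σ / (Real.pi - δ)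
        + Real.pi * σ * Real.sqrt δ) * (1 / γ ^ 2)
    + (8 * Real.sqrt δ / (Real.pi - δ) ^ 2 + 32 / (Real.pi - δ) + 10 * Real.sqrt δ)
        * (1 / ((Real.pi - δ) * γ))

end

end AverageSampling

/-! The error at `t` is the pairing of the Fourier transform `F` of `f` with an explicit function,
and Parseval on one period controls that function with truncation and Gaussian damping treated
together.

Since `F` lives on `[-δ, δ]`, the average sample at `j` is a Fourier integral of `F · W`. Hence `f
t` minus the series equals `(2π)^{-1/2} ∫ F W D` over `[-δ, δ]`, where `D` is `e^{itξ} / W(ξ)` minus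
a trigonometric polynomial. On `[-δ, δ]` the function `e^{itξ} / W(ξ)` is the `2π`-periodization of
`φ̂(ξ) e^{itξ}` (`fold`), because the translates of the support of `φ̂` do not reach that interval.
By Poisson summation (`fourierCoeffOn_fold`) the coefficients of the periodization are the values
`φ(t - j)`, up to normalization. The polynomial has the same coefficients multiplied by weights `w
j`, understood as zero outside the summation range, so `D` has the original coefficients times `1 -
w j`.

The Gaussian weights satisfy `|1 - w j| ≤ κ (t - j)²` with `κ = n^{-5/3}`; for omitted indices this
holds because `|t - j| ≥ n`. The factor `(t - j)²` costs two derivatives: `φ̂` is `C¹` and piecewise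
`C²`, so multiplying its transform by `-s²` amounts to replacing `φ̂` by its piecewise second
derivative (`piecewiseFourier_deriv2`). Parseval then bounds the `L²` norm of `D` by `κ` times that
of the folded second derivative, which is estimated from the lower bound `γ` for `|W|` on `[-δ, δ]`.
Cauchy–Schwarz, with `|W| ≤ 1`, finishes; the constant obtained is smaller than the stated one. -/

namespace AverageSampling

/-! ### Fourier inversion for Paley–Wiener functions. -/

/-- The inverse Fourier transform of an integrable function is continuous. -/
theorem continuous_fourierInv_of_integrable {g : ℝ → ℂ} (hg : Integrable g) :
    Continuous (𝓕⁻ g) :=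
  VectorFourier.fourierIntegral_continuous (L := -innerₗ ℝ) Real.continuous_fourierChar
    (by simp only [LinearMap.neg_apply, innerₗ_apply_apply]; fun_prop) hg

/-- Self-adjointness of the inverse Fourier transform on integrable functions. -/
theorem integral_fourierInv_mul_eq_of_integrable {f g : ℝ → ℂ} (hf : Integrable f)
    (hg : Integrable g) : ∫ ξ, 𝓕⁻ f ξ * g ξ = ∫ x, f x * 𝓕⁻ g x := by
  have h := VectorFourier.integral_fourierIntegral_smul_eq_flip (L := -innerₗ ℝ)
    Real.continuous_fourierChar
    (by simp only [LinearMap.neg_apply, innerₗ_apply_apply]; fun_prop) hf hg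
  have hflip : (-innerₗ ℝ).flip = -innerₗ ℝ := by
    ext
    simp
  rw [hflip] at h
  exact h

/-- Fourier inversion for a continuous square-integrable function with integrable transform. -/
theorem eq_fourierInv_of_integrable_fourier {f : ℝ → ℂ} (hc : Continuous f)
    (hf : MemLp f 2 (volume : Measure ℝ))
    (hg : Integrable (𝓕 (hf.toLp f : Lp ℂ 2 (volume : Measure ℝ)) :
      Lp ℂ 2 (volume : Measure ℝ))) :
    f = 𝓕⁻ (((𝓕 (hf.toLp f : Lp ℂ 2 (volume : Measure ℝ)) :
      Lp ℂ 2 (volume : Measure ℝ))) : ℝ → ℂ) := by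
  set G : Lp ℂ 2 (volume : Measure ℝ) := 𝓕 (hf.toLp f : Lp ℂ 2 (volume : Measure ℝ)) with hG
  have hgc := continuous_fourierInv_of_integrable hg
  have hae : ∀ᵐ x, f x = 𝓕⁻ (G : ℝ → ℂ) x := by
    apply ae_eq_of_integral_contDiff_smul_eq hc.locallyIntegrable hgc.locallyIntegrable
    intro u hu hus
    have hu' : ContDiff ℝ (⊤ : ℕ∞) (fun x => (u x : ℂ)) :=
      Complex.ofRealCLM.contDiff.comp hu
    have hus' : HasCompactSupport (fun x => (u x : ℂ)) := hus.comp_left (g := fun x : ℝ => (x : ℂ))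
      Complex.ofReal_zero
    set s : SchwartzMap ℝ ℂ := hus'.toSchwartzMap hu' with hs
    have hsu : ∀ x, s x = (u x : ℂ) := fun x => rfl
    -- The `L²` transform agrees with the distributional one; pairing it with `𝓕⁻ s` recovers the
    -- pairing of `f` with `s`.
    have h1 := congrArg (fun T : TemperedDistribution ℝ ℂ => T (𝓕⁻ s))
      (Lp.fourier_toTemperedDistribution_eq (hf.toLp f : Lp ℂ 2 (volume : Measure ℝ)))
    simp only [TemperedDistribution.fourier_apply, FourierTransform.fourier_fourierInv_eq,
      Lp.toTemperedDistribution_apply, smul_eq_mul] at h1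
    rw [← hG] at h1
    have h2 := integral_fourierInv_mul_eq_of_integrable s.integrable hg
    calc ∫ x, u x • f x = ∫ x, s x * (hf.toLp f) x := by
          apply integral_congr_ae
          filter_upwards [hf.coeFn_toLp] with x hx
          rw [hx, hsu, Complex.real_smul]
      _ = ∫ x, (𝓕⁻ s) x * G x := h1
      _ = ∫ x, s x * 𝓕⁻ (G : ℝ → ℂ) x := by
          rw [← h2, SchwartzMap.fourierInv_coe]
      _ = ∫ x, u x • 𝓕⁻ (G : ℝ → ℂ) x := by
          congr 1
  exact hc.ae_eq_iff_eq volume hgc |>.1 hae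

/-- Functions in the Paley–Wiener space are Fourier integrals of square-integrable functions
supported in `[-δ, δ]`. -/
theorem PaleyWiener.exists_fourier_integral {δ : ℝ} {f : ℝ → ℂ} (hf : f ∈ PaleyWiener δ)
    (hf1 : eLpNorm f 2 volume ≤ 1) :
    ∃ F : ℝ → ℂ, MemLp F 2 (volume : Measure ℝ) ∧ (∀ ξ ∉ Set.Icc (-δ) δ, F ξ = 0) ∧
      ∫ ξ, ‖F ξ‖ ^ 2 ≤ 1 ∧
      ∀ t : ℝ, f t = ((Real.sqrt (2 * Real.pi))⁻¹ : ℂ) *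
        ∫ ξ : ℝ, F ξ * Complex.exp (Complex.I * (t : ℂ) * (ξ : ℂ)) := by
  obtain ⟨hc, hm, hsupp⟩ := hf
  set G : Lp ℂ 2 (volume : Measure ℝ) := 𝓕 (hm.toLp f : Lp ℂ 2 (volume : Measure ℝ)) with hG
  have hpi : (0 : ℝ) < 2 * Real.pi := by positivity
  have hsq : (0 : ℝ) < Real.sqrt (2 * Real.pi) := Real.sqrt_pos.2 hpi
  -- The transform vanishes off `[-δ, δ]` only almost everywhere; truncation selects a
  -- representative that vanishes there everywhere.
  set Q : ℝ → ℂ := (Set.Icc (-δ) δ).indicator (plancherel f hm) with hQ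
  have hQae : Q =ᵐ[volume] plancherel f hm := by
    filter_upwards [hsupp] with ξ hξ
    by_cases h : ξ ∈ Set.Icc (-δ) δ
    · simp [hQ, h]
    · simp [hQ, h, hξ h]
  have hqmp : Measure.QuasiMeasurePreserving (fun ξ : ℝ => ξ * (2 * Real.pi)) volume volume := by
    refine ⟨by fun_prop, ?_⟩
    rw [Real.map_volume_mul_right hpi.ne']
    exact Measure.smul_absolutelyContinuous
  have hPG : ∀ η : ℝ, plancherel f hm (η * (2 * Real.pi)) =
      ((Real.sqrt (2 * Real.pi))⁻¹ : ℂ) * G η := by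
    intro η
    simp only [plancherel, ← hG]
    rw [mul_div_cancel_right₀ _ hpi.ne']
  have hGQ : ∀ᵐ η : ℝ, G η = (Real.sqrt (2 * Real.pi) : ℂ) * Q (η * (2 * Real.pi)) := by
    filter_upwards [hqmp.ae hQae] with η hη
    rw [hη, hPG, mul_inv_cancel_left₀]
    exact_mod_cast hsq.ne'
  have hGm : MemLp (G : ℝ → ℂ) 2 volume := Lp.memLp G
  have hqmp' : Measure.QuasiMeasurePreserving (fun ξ : ℝ => ξ / (2 * Real.pi)) volume volume := by
    refine ⟨by fun_prop, ?_⟩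
    simp_rw [div_eq_mul_inv]
    rw [Real.map_volume_mul_right (inv_ne_zero hpi.ne')]
    exact Measure.smul_absolutelyContinuous
  have hPmeas : AEStronglyMeasurable (plancherel f hm) volume :=
    (hGm.1.comp_quasiMeasurePreserving hqmp').const_mul _
  have hQmeas : AEStronglyMeasurable Q volume := hPmeas.congr hQae.symm
  have hGsq : Integrable (fun η => ‖G η‖ ^ 2) := (memLp_two_iff_integrable_sq_norm hGm.1).1 hGm
  have hPsq : Integrable (fun ξ => ‖plancherel f hm ξ‖ ^ 2) := by
    have := (hGsq.comp_div hpi.ne').const_mul ((Real.sqrt (2 * Real.pi))⁻¹ ^ 2)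
    refine this.congr (Filter.Eventually.of_forall fun ξ => ?_)
    simp only [plancherel, ← hG, norm_mul, mul_pow, norm_inv, Complex.norm_real,
      Real.norm_of_nonneg hsq.le]
  have hQm : MemLp Q 2 volume :=
    MemLp.ae_eq hQae.symm ((memLp_two_iff_integrable_sq_norm hPmeas).2 hPsq)
  -- Square-integrability on a bounded interval gives integrability, which is what pointwise
  -- inversion needs.
  have hQint : Integrable Q := by
    have h2 : MemLp Q 2 (volume.restrict (Set.Icc (-δ) δ)) := hQm.restrict _
    have h1 : IntegrableOn Q (Set.Icc (-δ) δ) := h2.integrable (by norm_num)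
    rw [← integrable_indicator_iff measurableSet_Icc] at h1
    simpa [hQ, Set.indicator_indicator] using h1
  have hGint : Integrable (G : ℝ → ℂ) := by
    have := (hQint.comp_mul_right' hpi.ne').const_mul (Real.sqrt (2 * Real.pi) : ℂ)
    exact this.congr (hGQ.mono fun _ h => h.symm)
  have hnormG : ∫ η, ‖G η‖ ^ 2 ≤ 1 := by
    have h1 : ‖G‖ ≤ 1 := by
      rw [hG, Lp.norm_fourier_eq, Lp.norm_toLp]
      exact ENNReal.toReal_le_of_le_ofReal zero_le_one (by simpa using hf1)
    have h2 : ‖G‖ ^ 2 = ∫ η, ‖G η‖ ^ 2 := by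
      have := @L2.inner_def ℝ ℂ ℂ _ _ _ _ _ G G
      have h3 := inner_self_eq_norm_sq_to_K (𝕜 := ℂ) G
      rw [this] at h3
      simp only [inner_self_eq_norm_sq_to_K] at h3
      have h4 : ∫ η, ((‖G η‖ ^ 2 : ℝ) : ℂ) = ((‖G‖ ^ 2 : ℝ) : ℂ) := by
        push_cast
        exact h3
      rw [integral_complex_ofReal] at h4
      exact_mod_cast h4.symm
    rw [← h2]
    nlinarith [norm_nonneg G]
  refine ⟨Q, hQm, fun ξ hξ => by simp [hQ, hξ], ?_, fun t => ?_⟩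
  · calc ∫ ξ, ‖Q ξ‖ ^ 2 = ∫ ξ, (2 * Real.pi)⁻¹ * ‖G (ξ / (2 * Real.pi))‖ ^ 2 := by
          apply integral_congr_ae
          filter_upwards [hQae] with ξ hξ
          rw [hξ]
          simp only [plancherel, ← hG, norm_mul, mul_pow, norm_inv, Complex.norm_real,
            Real.norm_of_nonneg hsq.le, inv_pow, Real.sq_sqrt hpi.le]
      _ = ∫ η, ‖G η‖ ^ 2 := by
          rw [integral_const_mul,
            Measure.integral_comp_div (fun η => ‖G η‖ ^ 2) (2 * Real.pi), abs_of_pos hpi,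
            smul_eq_mul, inv_mul_cancel_left₀ hpi.ne']
      _ ≤ 1 := hnormG
  · have hinv := congrFun (eq_fourierInv_of_integrable_fourier hc hm hGint) t
    rw [hinv, Real.fourierInv_eq']
    calc ∫ η, Complex.exp (↑(2 * Real.pi * inner ℝ η t) * Complex.I) • (G : ℝ → ℂ) η
        = ∫ η, (Real.sqrt (2 * Real.pi) : ℂ) * (Q (η * (2 * Real.pi)) *
            Complex.exp (Complex.I * t * (η * (2 * Real.pi) : ℝ))) := by
          apply integral_congr_ae
          filter_upwards [hGQ] with η hη
          rw [hη, smul_eq_mul]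
          have : (↑(2 * Real.pi * inner ℝ η t) * Complex.I : ℂ) =
              Complex.I * t * (η * (2 * Real.pi) : ℝ) := by
            simp
            ring
          rw [this]
          ring
      _ = _ := by
          rw [integral_const_mul, Measure.integral_comp_mul_right (fun ξ : ℝ => Q ξ *
            Complex.exp (Complex.I * t * ξ)), abs_of_pos (inv_pos.2 hpi), Complex.real_smul,
            ← mul_assoc]
          congr 1
          have h0 : (Real.sqrt (2 * Real.pi) : ℂ) ≠ 0 := by exact_mod_cast hsq.ne'
          have h1 : (((2 * Real.pi : ℝ)) : ℂ) =
              (Real.sqrt (2 * Real.pi) : ℂ) * (Real.sqrt (2 * Real.pi) : ℂ) := by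
            rw [← Complex.ofReal_mul, Real.mul_self_sqrt hpi.le]
          rw [Complex.ofReal_inv, h1]
          field_simp

/-! ### The multiplier `W` and the derivatives of `1 / W`. -/

/-- The `k`-th derivative of `W`, as the integral `∫ (it)^k e^{itξ} dν(t)`. -/
noncomputable def iterW (ν : Measure ℝ) (σ : ℝ) (k : ℕ) (ξ : ℝ) : ℂ :=
  ∫ t in Set.Icc (-(σ / 2)) (σ / 2),
    (Complex.I * (t : ℂ)) ^ k * Complex.exp (Complex.I * (t : ℂ) * (ξ : ℂ)) ∂ν

theorem iterW_zero (ν : Measure ℝ) (σ : ℝ) : iterW ν σ 0 = W ν σ := by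
  ext ξ
  simp [iterW, W]

theorem norm_exp_I_mul_mul (t ξ : ℝ) : ‖Complex.exp (Complex.I * (t : ℂ) * (ξ : ℂ))‖ = 1 := by
  rw [mul_assoc, ← Complex.ofReal_mul, Complex.norm_exp_I_mul_ofReal]

theorem norm_iterW_integrand (k : ℕ) (t ξ : ℝ) :
    ‖(Complex.I * (t : ℂ)) ^ k * Complex.exp (Complex.I * (t : ℂ) * (ξ : ℂ))‖ = |t| ^ k := by
  rw [norm_mul, norm_exp_I_mul_mul, mul_one, norm_pow, norm_mul, Complex.norm_I, one_mul,
    Complex.norm_real, Real.norm_eq_abs]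

theorem integrable_iterW_integrand (ν : Measure ℝ) [IsFiniteMeasure ν] (σ : ℝ) (k : ℕ) (ξ : ℝ) :
    IntegrableOn (fun t : ℝ => (Complex.I * (t : ℂ)) ^ k *
      Complex.exp (Complex.I * (t : ℂ) * (ξ : ℂ))) (Set.Icc (-(σ / 2)) (σ / 2)) ν := by
  have h : Continuous (fun t : ℝ => (Complex.I * (t : ℂ)) ^ k *
      Complex.exp (Complex.I * (t : ℂ) * (ξ : ℂ))) := by fun_prop
  exact h.continuousOn.integrableOn_compact isCompact_Icc

theorem hasDerivAt_iterW (ν : Measure ℝ) [IsFiniteMeasure ν] (σ : ℝ) (k : ℕ) (ξ : ℝ) :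
    HasDerivAt (iterW ν σ k) (iterW ν σ (k + 1) ξ) ξ := by
  refine (hasDerivAt_integral_of_dominated_loc_of_deriv_le (F := fun (ξ t : ℝ) =>
    (Complex.I * (t : ℂ)) ^ k * Complex.exp (Complex.I * (t : ℂ) * (ξ : ℂ)))
    (F' := fun (ξ t : ℝ) =>
    (Complex.I * (t : ℂ)) ^ (k + 1) * Complex.exp (Complex.I * (t : ℂ) * (ξ : ℂ)))
    (bound := fun t => |t| ^ (k + 1)) (Filter.univ_mem) ?_ ?_ ?_ ?_ ?_ ?_).2
  · exact Filter.Eventually.of_forall fun x =>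
      (integrable_iterW_integrand ν σ k x).aestronglyMeasurable
  · exact integrable_iterW_integrand ν σ k ξ
  · exact (integrable_iterW_integrand ν σ (k + 1) ξ).aestronglyMeasurable
  · exact Filter.Eventually.of_forall fun t x _ => (norm_iterW_integrand (k + 1) t x).le
  · have h : Continuous (fun t : ℝ => |t| ^ (k + 1)) := by fun_prop
    exact h.continuousOn.integrableOn_compact isCompact_Icc
  · refine Filter.Eventually.of_forall fun t x _ => ?_
    have h1 : HasDerivAt (fun x : ℝ => Complex.I * (t : ℂ) * (x : ℂ)) (Complex.I * (t : ℂ)) x := by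
      simpa using (Complex.ofRealCLM.hasDerivAt (x := x)).const_mul (Complex.I * (t : ℂ))
    have h2 := h1.cexp.const_mul ((Complex.I * (t : ℂ)) ^ k)
    convert! h2 using 1
    ring

theorem norm_iterW_le (ν : Measure ℝ) [IsProbabilityMeasure ν] {σ : ℝ} (hσ : 0 ≤ σ) (k : ℕ)
    (ξ : ℝ) : ‖iterW ν σ k ξ‖ ≤ (σ / 2) ^ k := by
  have h := norm_setIntegral_le_of_norm_le_const (μ := ν) (s := Set.Icc (-(σ / 2)) (σ / 2))
    (f := fun t : ℝ => (Complex.I * (t : ℂ)) ^ k * Complex.exp (Complex.I * (t : ℂ) * (ξ : ℂ)))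
    (C := (σ / 2) ^ k) (measure_lt_top _ _) fun t ht => by
      rw [norm_iterW_integrand]
      exact pow_le_pow_left₀ (abs_nonneg t) (abs_le.2 ht) k
  refine h.trans (mul_le_of_le_one_right (by positivity) measureReal_le_one)

/-- The symmetry of `ν` enters here: it makes `W` even and `W'` odd, so that gluing at `δ` also
gives gluing at `-δ`. -/
theorem iterW_neg {ν : Measure ℝ} (hν : ν.map (fun x => -x) = ν) (σ : ℝ) (k : ℕ) (ξ : ℝ) :
    iterW ν σ k (-ξ) = (-1) ^ k * iterW ν σ k ξ := by
  have hpre : (fun x : ℝ => -x) ⁻¹' Set.Icc (-(σ / 2)) (σ / 2) = Set.Icc (-(σ / 2)) (σ / 2) := by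
    ext x
    simp only [Set.mem_preimage, Set.mem_Icc]
    constructor <;> rintro ⟨h1, h2⟩ <;> constructor <;> linarith
  have hemb : MeasurableEmbedding (fun x : ℝ => -x) := (MeasurableEquiv.neg ℝ).measurableEmbedding
  rw [iterW]
  nth_rewrite 1 [← hν]
  rw [hemb.setIntegral_map, hpre, iterW, ← integral_const_mul]
  refine integral_congr_ae (Filter.Eventually.of_forall fun t => ?_)
  simp only [Complex.ofReal_neg, mul_neg, neg_mul, neg_neg]
  rw [neg_pow, mul_assoc]

/-- The real part of `W ξ` averages `cos (t ξ)` over `|t ξ| ≤ σ δ / 2`, where cosine is at least its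
value at the endpoint. -/
theorem cos_le_norm_W {ν : Measure ℝ} [IsProbabilityMeasure ν] {σ δ : ℝ} (hσ : 0 ≤ σ)
    (hν : ν (Set.Icc (-(σ / 2)) (σ / 2))ᶜ = 0) (hσδ : σ * δ ≤ Real.pi) {ξ : ℝ} (hξ : |ξ| ≤ δ) :
    Real.cos (σ * δ / 2) ≤ ‖W ν σ ξ‖ := by
  have hint : IntegrableOn (fun t : ℝ => Complex.exp (Complex.I * (t : ℂ) * (ξ : ℂ)))
      (Set.Icc (-(σ / 2)) (σ / 2)) ν := by
    simpa using integrable_iterW_integrand ν σ 0 ξ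
  have hone : ν.real (Set.Icc (-(σ / 2)) (σ / 2)) = 1 := by
    rw [measureReal_def, (prob_compl_eq_zero_iff measurableSet_Icc).1 hν, ENNReal.toReal_one]
  have hre : (W ν σ ξ).re = ∫ t in Set.Icc (-(σ / 2)) (σ / 2), Real.cos (t * ξ) ∂ν := by
    have h := integral_re hint
    simp only [RCLike.re_eq_complex_re] at h
    rw [W, ← h]
    refine integral_congr_ae (Filter.Eventually.of_forall fun t => ?_)
    simp only
    rw [mul_assoc, ← Complex.ofReal_mul, mul_comm, Complex.exp_ofReal_mul_I_re]
  have hcos : Continuous fun t : ℝ => Real.cos (t * ξ) := by fun_prop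
  have hle : Real.cos (σ * δ / 2) ≤ (W ν σ ξ).re := by
    rw [hre]
    calc Real.cos (σ * δ / 2)
        = ∫ t in Set.Icc (-(σ / 2)) (σ / 2), Real.cos (σ * δ / 2) ∂ν := by
          rw [setIntegral_const, hone, one_smul]
      _ ≤ _ := by
          refine setIntegral_mono_on (integrable_const _)
            (hcos.continuousOn.integrableOn_compact isCompact_Icc) measurableSet_Icc
            fun t ht => ?_
          rw [← Real.cos_abs (t * ξ), abs_mul]
          have h1 : |t| * |ξ| ≤ σ / 2 * δ :=
            mul_le_mul (abs_le.2 ht) hξ (abs_nonneg _) (by positivity)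
          exact Real.cos_le_cos_of_nonneg_of_le_pi (by positivity)
            (by nlinarith [Real.pi_pos]) (by linarith)
  exact hle.trans (Complex.re_le_norm _)

/-- The second derivative of `1 / W`. -/
noncomputable def invWDeriv2 (ν : Measure ℝ) (σ ξ : ℝ) : ℂ :=
  2 * iterW ν σ 1 ξ ^ 2 / W ν σ ξ ^ 3 - iterW ν σ 2 ξ / W ν σ ξ ^ 2

theorem hasDerivAt_W (ν : Measure ℝ) [IsFiniteMeasure ν] (σ ξ : ℝ) :
    HasDerivAt (W ν σ) (iterW ν σ 1 ξ) ξ := by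
  simpa [iterW_zero] using hasDerivAt_iterW ν σ 0 ξ

theorem hasDerivAt_inv_W (ν : Measure ℝ) [IsFiniteMeasure ν] {σ ξ : ℝ} (h : W ν σ ξ ≠ 0) :
    HasDerivAt (fun ξ => 1 / W ν σ ξ) (-(iterW ν σ 1 ξ / W ν σ ξ ^ 2)) ξ := by
  simpa [one_div, neg_div] using (hasDerivAt_W ν σ ξ).fun_inv h

theorem hasDerivAt_deriv_inv_W (ν : Measure ℝ) [IsFiniteMeasure ν] {σ ξ : ℝ} (h : W ν σ ξ ≠ 0) :
    HasDerivAt (fun ξ => -(iterW ν σ 1 ξ / W ν σ ξ ^ 2)) (invWDeriv2 ν σ ξ) ξ := by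
  have h1 := ((hasDerivAt_iterW ν σ 1 ξ).fun_div ((hasDerivAt_W ν σ ξ).fun_pow 2)
    (pow_ne_zero 2 h)).fun_neg
  convert! h1 using 1
  rw [invWDeriv2]
  field_simp
  push_cast
  ring

theorem continuous_iterW (ν : Measure ℝ) [IsFiniteMeasure ν] (σ : ℝ) (k : ℕ) :
    Continuous (iterW ν σ k) :=
  continuous_iff_continuousAt.2 fun ξ => (hasDerivAt_iterW ν σ k ξ).continuousAt

theorem continuous_W (ν : Measure ℝ) [IsFiniteMeasure ν] (σ : ℝ) : Continuous (W ν σ) :=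
  iterW_zero ν σ ▸ continuous_iterW ν σ 0

/-- The `k`-th derivative of `W` is at most `(σ / 2) ^ k`, and `γ ≤ 1` puts both terms over `γ ^ 3`;
the sum is `3 / 4` of the bound. -/
theorem norm_invWDeriv2_le (ν : Measure ℝ) [IsProbabilityMeasure ν] {σ γ ξ : ℝ} (hσ : 0 ≤ σ)
    (hγ : 0 < γ) (hγ1 : γ ≤ 1) (h : γ ≤ ‖W ν σ ξ‖) :
    ‖invWDeriv2 ν σ ξ‖ ≤ σ ^ 2 / γ ^ 3 := by
  have h1 : ‖iterW ν σ 1 ξ‖ ^ 2 ≤ (σ / 2) ^ 2 :=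
    pow_le_pow_left₀ (norm_nonneg _) (by simpa using norm_iterW_le ν hσ 1 ξ) 2
  have h2 := norm_iterW_le ν hσ 2 ξ
  have h3 : γ ^ 3 ≤ ‖W ν σ ξ‖ ^ 3 := pow_le_pow_left₀ hγ.le h 3
  have h4 : γ ^ 2 ≤ ‖W ν σ ξ‖ ^ 2 := pow_le_pow_left₀ hγ.le h 2
  have h5 : γ ^ 3 ≤ γ ^ 2 := pow_le_pow_of_le_one hγ.le hγ1 (by norm_num)
  calc ‖invWDeriv2 ν σ ξ‖
      ≤ 2 * ‖iterW ν σ 1 ξ‖ ^ 2 / ‖W ν σ ξ‖ ^ 3 + ‖iterW ν σ 2 ξ‖ / ‖W ν σ ξ‖ ^ 2 := by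
        refine (norm_sub_le _ _).trans (le_of_eq ?_)
        simp only [norm_div, norm_mul, norm_pow, Complex.norm_ofNat]
    _ ≤ 2 * (σ / 2) ^ 2 / γ ^ 3 + (σ / 2) ^ 2 / γ ^ 3 := by
        have := h5.trans h4
        gcongr
    _ = (3 / 4) * (σ ^ 2 / γ ^ 3) := by ring
    _ ≤ σ ^ 2 / γ ^ 3 := by
        have : 0 ≤ σ ^ 2 / γ ^ 3 := by positivity
        linarith

/-! ### Glued Fourier integrals, periodization and Poisson summation. -/

/-- The Fourier integral of the even function equal to `u` on `[-δ, δ]`, to `v(|ξ|)` for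
`δ < |ξ| ≤ 2π - δ`, and to zero elsewhere. -/
noncomputable def piecewiseFourier (δ : ℝ) (u v : ℝ → ℂ) (s : ℝ) : ℂ :=
  (∫ ξ in -δ..δ, u ξ * Complex.exp (Complex.I * s * ξ)) +
    (∫ ξ in δ..(2 * Real.pi - δ), v ξ * Complex.exp (Complex.I * s * ξ)) +
    ∫ ξ in δ..(2 * Real.pi - δ), v ξ * Complex.exp (Complex.I * (-s : ℝ) * ξ)

/-- The `2π`-periodization on `[-δ, 2π - δ]` of the integrand of `piecewiseFourier`. -/
noncomputable def fold (δ t : ℝ) (u v : ℝ → ℂ) (ξ : ℝ) : ℂ :=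
  if ξ ≤ δ then u ξ * Complex.exp (Complex.I * t * ξ)
  else v ξ * Complex.exp (Complex.I * t * ξ) +
    v (2 * Real.pi - ξ) * Complex.exp (Complex.I * t * (ξ - 2 * Real.pi : ℝ))

theorem hasDerivAt_exp_I_mul_mul (s ξ : ℝ) :
    HasDerivAt (fun ξ : ℝ => Complex.exp (Complex.I * s * ξ))
      (Complex.exp (Complex.I * s * ξ) * (Complex.I * s)) ξ := by
  have h1 : HasDerivAt (fun x : ℝ => Complex.I * (s : ℂ) * (x : ℂ)) (Complex.I * (s : ℂ)) ξ := by
    simpa using (Complex.ofRealCLM.hasDerivAt (x := ξ)).const_mul (Complex.I * (s : ℂ))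
  exact h1.cexp

theorem continuous_exp_I_mul_mul (s : ℝ) :
    Continuous (fun ξ : ℝ => Complex.exp (Complex.I * s * ξ)) := by fun_prop

/-- Integration by parts twice against a character. -/
theorem integral_deriv2_mul_exp {a b s : ℝ} {g g₁ g₂ : ℝ → ℂ}
    (h₁ : ∀ x ∈ Set.uIcc a b, HasDerivAt g (g₁ x) x)
    (h₂ : ∀ x ∈ Set.uIcc a b, HasDerivAt g₁ (g₂ x) x) (hc : ContinuousOn g₂ (Set.uIcc a b)) :
    ∫ ξ in a..b, g₂ ξ * Complex.exp (Complex.I * s * ξ) =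
      (g₁ b - Complex.I * s * g b) * Complex.exp (Complex.I * s * b)
        - (g₁ a - Complex.I * s * g a) * Complex.exp (Complex.I * s * a)
        - (s : ℂ) ^ 2 * ∫ ξ in a..b, g ξ * Complex.exp (Complex.I * s * ξ) := by
  have he := (continuous_exp_I_mul_mul s).continuousOn (s := Set.uIcc a b)
  have hg : ContinuousOn g (Set.uIcc a b) := fun x hx => (h₁ x hx).continuousAt.continuousWithinAt
  have i₂ : IntervalIntegrable (fun ξ : ℝ => g₂ ξ * Complex.exp (Complex.I * s * ξ)) volume a b :=
    (hc.mul he).intervalIntegrable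
  have i₀ : IntervalIntegrable
      (fun ξ : ℝ => (s : ℂ) ^ 2 * (g ξ * Complex.exp (Complex.I * s * ξ))) volume a b :=
    ((hg.mul he).intervalIntegrable).const_mul _
  have h := intervalIntegral.integral_eq_sub_of_hasDerivAt
    (f := fun ξ : ℝ => (g₁ ξ - Complex.I * s * g ξ) * Complex.exp (Complex.I * s * ξ))
    (f' := fun ξ : ℝ => g₂ ξ * Complex.exp (Complex.I * s * ξ) +
      (s : ℂ) ^ 2 * (g ξ * Complex.exp (Complex.I * s * ξ))) (a := a) (b := b)
    (fun x hx => by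
      convert! ((h₂ x hx).fun_sub ((h₁ x hx).const_mul (Complex.I * s))).fun_mul
        (hasDerivAt_exp_I_mul_mul s x) using 1
      linear_combination ((s : ℂ) ^ 2 * g x * Complex.exp (Complex.I * s * x)) * Complex.I_sq)
    (i₂.add i₀)
  rw [intervalIntegral.integral_add i₂ i₀, intervalIntegral.integral_const_mul] at h
  linear_combination h

/-- If the pieces `u` and `v` glue to an even `C¹` function vanishing to second order at
`2π - δ`, two derivatives turn into multiplication by `-s²`. -/
theorem piecewiseFourier_deriv2 {δ s : ℝ} {u u₁ u₂ v v₁ v₂ : ℝ → ℂ}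
    (hu₁ : ∀ x ∈ Set.uIcc (-δ) δ, HasDerivAt u (u₁ x) x)
    (hu₂ : ∀ x ∈ Set.uIcc (-δ) δ, HasDerivAt u₁ (u₂ x) x)
    (huc : ContinuousOn u₂ (Set.uIcc (-δ) δ))
    (hv₁ : ∀ x, HasDerivAt v (v₁ x) x) (hv₂ : ∀ x, HasDerivAt v₁ (v₂ x) x) (hvc : Continuous v₂)
    (e0 : u (-δ) = u δ) (e1 : u₁ (-δ) = -u₁ δ) (e2 : v δ = u δ) (e3 : v₁ δ = u₁ δ)
    (e4 : v (2 * Real.pi - δ) = 0) (e5 : v₁ (2 * Real.pi - δ) = 0) :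
    piecewiseFourier δ u₂ v₂ s = -(s : ℂ) ^ 2 * piecewiseFourier δ u v s := by
  simp only [piecewiseFourier]
  rw [integral_deriv2_mul_exp hu₁ hu₂ huc,
    integral_deriv2_mul_exp (fun x _ => hv₁ x) (fun x _ => hv₂ x) hvc.continuousOn,
    integral_deriv2_mul_exp (fun x _ => hv₁ x) (fun x _ => hv₂ x) hvc.continuousOn,
    e0, e1, e2, e3, e4, e5]
  -- The boundary terms of the middle piece at `δ` cancel those of the outer piece; by parity, those
  -- at `-δ` cancel against the reflected outer piece, taken at frequency `-s`.
  simp only [Complex.ofReal_neg, mul_neg, neg_mul, sub_neg_eq_add]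
  ring

/-- Poisson summation in finite form: over one period the translated negative outer piece overlaps
the positive one, and unfolding the overlap restores the integral over the line. -/
theorem fourierCoeffOn_fold {δ t : ℝ} (hδ : 0 < δ) (hδπ : δ < Real.pi)
    (hab : -δ < 2 * Real.pi - δ) {u v : ℝ → ℂ}
    (hu : ContinuousOn u (Set.uIcc (-δ) δ)) (hv : Continuous v) (j : ℤ) :
    fourierCoeffOn hab (fold δ t u v) j =
      (2 * Real.pi : ℂ)⁻¹ * piecewiseFourier δ u v (t - j) := by
  have hpi := Real.pi_pos
  have hch : ∀ ξ : ℝ, (fourier (-j) (ξ : AddCircle (2 * Real.pi - δ - -δ)) : ℂ) =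
      Complex.exp (Complex.I * (-j : ℝ) * ξ) := by
    intro ξ
    rw [fourier_coe_apply]
    congr 1
    have : ((2 * Real.pi - δ - -δ : ℝ) : ℂ) = 2 * Real.pi := by push_cast; ring
    rw [this]
    have : (Real.pi : ℂ) ≠ 0 := by exact_mod_cast hpi.ne'
    field_simp
    push_cast
    ring
  have hmul : ∀ s ξ : ℝ, Complex.exp (Complex.I * (-j : ℝ) * ξ) *
      Complex.exp (Complex.I * s * ξ) = Complex.exp (Complex.I * (s - j : ℝ) * ξ) := by
    intro s ξ
    rw [← Complex.exp_add]
    congr 1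
    push_cast
    ring
  have hA : ∫ ξ in -δ..δ, Complex.exp (Complex.I * (-j : ℝ) * ξ) * fold δ t u v ξ =
      ∫ ξ in -δ..δ, u ξ * Complex.exp (Complex.I * (t - j : ℝ) * ξ) := by
    refine intervalIntegral.integral_congr fun ξ hξ => ?_
    rw [Set.uIcc_of_le (by linarith)] at hξ
    simp only [fold, if_pos hξ.2, ← hmul]
    ring
  have hB : ∫ ξ in δ..(2 * Real.pi - δ), Complex.exp (Complex.I * (-j : ℝ) * ξ) *
        fold δ t u v ξ =
      (∫ ξ in δ..(2 * Real.pi - δ), v ξ * Complex.exp (Complex.I * (t - j : ℝ) * ξ)) +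
      ∫ ξ in δ..(2 * Real.pi - δ), v ξ * Complex.exp (Complex.I * (-(t - j) : ℝ) * ξ) := by
    have hsub : ∫ ξ in δ..(2 * Real.pi - δ),
          v ξ * Complex.exp (Complex.I * (-(t - j) : ℝ) * ξ) =
        ∫ ξ in δ..(2 * Real.pi - δ), v (2 * Real.pi - ξ) *
          Complex.exp (Complex.I * (-(t - j) : ℝ) * (2 * Real.pi - ξ : ℝ)) := by
      rw [intervalIntegral.integral_comp_sub_left (fun ξ : ℝ =>
        v ξ * Complex.exp (Complex.I * (-(t - j) : ℝ) * ξ)), sub_sub_cancel]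
    rw [hsub, ← intervalIntegral.integral_add
      (Continuous.intervalIntegrable (by fun_prop) _ _)
      (Continuous.intervalIntegrable (by fun_prop) _ _)]
    refine intervalIntegral.integral_congr_ae (Filter.Eventually.of_forall fun ξ hξ => ?_)
    rw [Set.uIoc_of_le (by linarith)] at hξ
    simp only [fold, if_neg (not_le.2 hξ.1), mul_add]
    congr 1
    · rw [← hmul]
      ring
    · rw [mul_left_comm, ← Complex.exp_add]
      congr 1
      -- The translation by `2π` changes the phase by `2πj`, which is invisible because `j` is an
      -- integer.
      rw [Complex.exp_eq_exp_iff_exists_int]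
      refine ⟨-j, ?_⟩
      push_cast
      ring
  have hmeas1 : IntervalIntegrable
      (fun ξ : ℝ => Complex.exp (Complex.I * (-j : ℝ) * ξ) * fold δ t u v ξ) volume (-δ) δ := by
    refine IntervalIntegrable.congr (f := fun ξ : ℝ => Complex.exp (Complex.I * (-j : ℝ) * ξ) *
      (u ξ * Complex.exp (Complex.I * t * ξ))) ?_ ?_
    · intro ξ hξ
      rw [Set.uIoc_of_le (by linarith)] at hξ
      simp only [fold, if_pos hξ.2]
    · exact (((continuous_exp_I_mul_mul _).continuousOn.mul
        (hu.mul (continuous_exp_I_mul_mul _).continuousOn))).intervalIntegrable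
  have hmeas2 : IntervalIntegrable
      (fun ξ : ℝ => Complex.exp (Complex.I * (-j : ℝ) * ξ) * fold δ t u v ξ) volume δ
        (2 * Real.pi - δ) := by
    refine IntervalIntegrable.congr (f := fun ξ : ℝ => Complex.exp (Complex.I * (-j : ℝ) * ξ) *
      (v ξ * Complex.exp (Complex.I * t * ξ) +
    v (2 * Real.pi - ξ) * Complex.exp (Complex.I * t * (ξ - 2 * Real.pi : ℝ)))) ?_ ?_
    · intro ξ hξ
      rw [Set.uIoc_of_le (by linarith)] at hξ
      simp only [fold, if_neg (not_le.2 hξ.1)]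
    · exact Continuous.intervalIntegrable (by fun_prop) _ _
  rw [fourierCoeffOn_eq_integral]
  simp only [hch, smul_eq_mul]
  rw [← intervalIntegral.integral_add_adjacent_intervals hmeas1 hmeas2, hA, hB,
    Complex.real_smul, piecewiseFourier]
  push_cast
  ring

/-! ### The outer piece of `φ̂` and its matching conditions. -/

/-- The slope of the affine function `P`. -/
noncomputable def slope (ν : Measure ℝ) (σ δ : ℝ) : ℂ :=
  1 / (((Real.pi - δ : ℝ) : ℂ) * W ν σ δ) - iterW ν σ 1 δ / (W ν σ δ) ^ 2

/-- The polynomial giving `φ̂` on `[δ, 2π - δ]`. -/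
noncomputable def outer (ν : Measure ℝ) (σ δ ξ : ℝ) : ℂ :=
  (((ξ - (2 * Real.pi - δ)) / (2 * Real.pi - 2 * δ) : ℝ) : ℂ) ^ 2 *
    (1 / W ν σ δ + slope ν σ δ * ((ξ - δ : ℝ) : ℂ))

/-- The first derivative of `outer`. -/
noncomputable def outerDeriv (ν : Measure ℝ) (σ δ ξ : ℝ) : ℂ :=
  ((2 * (ξ - (2 * Real.pi - δ)) / (2 * Real.pi - 2 * δ) ^ 2 : ℝ) : ℂ) *
    (1 / W ν σ δ + slope ν σ δ * ((ξ - δ : ℝ) : ℂ)) +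
  (((ξ - (2 * Real.pi - δ)) / (2 * Real.pi - 2 * δ) : ℝ) : ℂ) ^ 2 * slope ν σ δ

/-- The second derivative of `outer`. -/
noncomputable def outerDeriv2 (ν : Measure ℝ) (σ δ ξ : ℝ) : ℂ :=
  ((2 / (2 * Real.pi - 2 * δ) ^ 2 : ℝ) : ℂ) *
    (1 / W ν σ δ + slope ν σ δ * ((ξ - δ : ℝ) : ℂ)) +
  ((4 * (ξ - (2 * Real.pi - δ)) / (2 * Real.pi - 2 * δ) ^ 2 : ℝ) : ℂ) * slope ν σ δ

theorem continuous_outer (ν : Measure ℝ) (σ δ : ℝ) : Continuous (outer ν σ δ) := by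
  unfold outer
  fun_prop

theorem continuous_outerDeriv2 (ν : Measure ℝ) (σ δ : ℝ) : Continuous (outerDeriv2 ν σ δ) := by
  unfold outerDeriv2
  fun_prop

theorem hasDerivAt_affine (w a : ℂ) (d ξ : ℝ) :
    HasDerivAt (fun ξ : ℝ => w + a * ((ξ - d : ℝ) : ℂ)) a ξ := by
  have h := (((hasDerivAt_id ξ).sub_const d).ofReal_comp.const_mul a).const_add w
  simpa using h

theorem hasDerivAt_outer (ν : Measure ℝ) (σ δ ξ : ℝ) :
    HasDerivAt (outer ν σ δ) (outerDeriv ν σ δ ξ) ξ := by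
  have h := ((((hasDerivAt_id ξ).sub_const (2 * Real.pi - δ)).div_const
    (2 * Real.pi - 2 * δ)).ofReal_comp.fun_pow 2).fun_mul
    (hasDerivAt_affine (1 / W ν σ δ) (slope ν σ δ) δ ξ)
  refine h.congr_deriv ?_
  simp only [outerDeriv, id_eq]
  generalize 2 * Real.pi - 2 * δ = L
  push_cast
  ring

theorem hasDerivAt_outerDeriv (ν : Measure ℝ) (σ δ ξ : ℝ) :
    HasDerivAt (outerDeriv ν σ δ) (outerDeriv2 ν σ δ ξ) ξ := by
  have h1 := ((((hasDerivAt_id ξ).sub_const (2 * Real.pi - δ)).const_mul 2).div_const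
    ((2 * Real.pi - 2 * δ) ^ 2)).ofReal_comp.fun_mul
    (hasDerivAt_affine (1 / W ν σ δ) (slope ν σ δ) δ ξ)
  have h2 := ((((hasDerivAt_id ξ).sub_const (2 * Real.pi - δ)).div_const
    (2 * Real.pi - 2 * δ)).ofReal_comp.fun_pow 2).mul_const (slope ν σ δ)
  refine (h1.fun_add h2).congr_deriv ?_
  simp only [outerDeriv2, id_eq]
  generalize 2 * Real.pi - 2 * δ = L
  push_cast
  ring

theorem outer_left {ν : Measure ℝ} {σ δ : ℝ} (hδπ : δ < Real.pi) :
    outer ν σ δ δ = 1 / W ν σ δ := by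
  have h : (δ - (2 * Real.pi - δ)) / (2 * Real.pi - 2 * δ) = -1 := by
    rw [div_eq_iff (by linarith)]
    ring
  rw [outer, h]
  simp

/-- The squared factor has value `1` and derivative `-1 / (π - δ)` at `δ`; the first term of `slope`
cancels the latter, leaving the derivative of `1 / W`. -/
theorem outerDeriv_left {ν : Measure ℝ} {σ δ : ℝ} (hδπ : δ < Real.pi) :
    outerDeriv ν σ δ δ = -(iterW ν σ 1 δ / W ν σ δ ^ 2) := by
  have hne : Real.pi - δ ≠ 0 := by linarith
  have h : (δ - (2 * Real.pi - δ)) / (2 * Real.pi - 2 * δ) = -1 := by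
    rw [div_eq_iff (by linarith)]
    ring
  have h' : 2 * (δ - (2 * Real.pi - δ)) / (2 * Real.pi - 2 * δ) ^ 2 = -(Real.pi - δ)⁻¹ := by
    have : 2 * Real.pi - 2 * δ = 2 * (Real.pi - δ) := by ring
    rw [this]
    field_simp
    ring
  rw [outerDeriv, h, h', slope]
  generalize Real.pi - δ = d
  push_cast
  simp only [sub_self, mul_zero, add_zero, div_eq_mul_inv]
  ring

theorem outer_right (ν : Measure ℝ) (σ δ : ℝ) : outer ν σ δ (2 * Real.pi - δ) = 0 := by
  simp [outer]

theorem outerDeriv_right (ν : Measure ℝ) (σ δ : ℝ) : outerDeriv ν σ δ (2 * Real.pi - δ) = 0 := by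
  simp [outerDeriv]

/-- Centring the affine factor at `δ` exposes the Hermite data for matching `1 / W` to first order.
-/
theorem P_eq {ν : Measure ℝ} [IsFiniteMeasure ν] {σ δ : ℝ} (hδπ : δ < Real.pi) (ξ : ℝ) :
    P ν σ δ ξ = 1 / W ν σ δ + slope ν σ δ * ((|ξ| - δ : ℝ) : ℂ) := by
  have hne : ((Real.pi - δ : ℝ) : ℂ) ≠ 0 := by
    exact_mod_cast (sub_pos.2 hδπ).ne'
  have h2 : ((Real.pi - 2 * δ : ℝ) : ℂ) = ((Real.pi - δ : ℝ) : ℂ) - δ := by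
    push_cast
    ring
  have h3 : ((Real.pi - 2 * δ : ℝ) : ℂ) / (((Real.pi - δ : ℝ) : ℂ) * W ν σ δ) =
      1 / W ν σ δ - δ * (1 / (((Real.pi - δ : ℝ) : ℂ) * W ν σ δ)) := by
    rw [h2, sub_div, div_mul_eq_div_div, div_self hne]
    ring
  rw [P, h3, slope, (hasDerivAt_W ν σ δ).deriv]
  push_cast
  ring

theorem phiHat_of_lt {ν : Measure ℝ} [IsFiniteMeasure ν] {σ δ ξ : ℝ} (hδπ : δ < Real.pi)
    (h1 : δ < |ξ|) (h2 : |ξ| ≤ 2 * Real.pi - δ) : phiHat ν σ δ ξ = outer ν σ δ |ξ| := by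
  rw [phiHat, if_neg (not_le.2 h1), if_pos h2, P_eq hδπ, outer]
  push_cast
  rfl

theorem phi_eq_piecewiseFourier {ν : Measure ℝ} [IsFiniteMeasure ν] {σ δ : ℝ} (hδ : 0 < δ)
    (hδπ : δ < Real.pi) (hW : ContinuousOn (fun ξ => 1 / W ν σ ξ) (Set.uIcc (-δ) δ)) (s : ℝ) :
    phi ν σ δ s = ((Real.sqrt (2 * Real.pi))⁻¹ : ℂ) *
      piecewiseFourier δ (fun ξ => 1 / W ν σ ξ) (outer ν σ δ) s := by
  set c := 2 * Real.pi - δ with hc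
  have hδc : δ < c := by linarith
  set g : ℝ → ℂ := fun ξ => phiHat ν σ δ ξ * Complex.exp (Complex.I * (s : ℂ) * (ξ : ℂ)) with hg
  have hcont := continuous_outer ν σ δ
  have hL : Set.EqOn g (fun ξ => outer ν σ δ (-ξ) * Complex.exp (Complex.I * (s : ℂ) * (ξ : ℂ)))
      (Set.Ico (-c) (-δ)) := by
    intro ξ hξ
    have habs : |ξ| = -ξ := abs_of_neg (by linarith [hξ.2])
    simp only [hg]
    rw [phiHat_of_lt hδπ (by linarith [hξ.2]) (by linarith [hξ.1]), habs]
  have hM : Set.EqOn g (fun ξ => 1 / W ν σ ξ * Complex.exp (Complex.I * (s : ℂ) * (ξ : ℂ)))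
      (Set.uIcc (-δ) δ) := by
    intro ξ hξ
    rw [Set.uIcc_of_le (by linarith)] at hξ
    simp only [hg, phiHat, if_pos (abs_le.2 hξ)]
  have hR : Set.EqOn g (fun ξ => outer ν σ δ ξ * Complex.exp (Complex.I * (s : ℂ) * (ξ : ℂ)))
      (Set.Ioc δ c) := by
    intro ξ hξ
    have habs : |ξ| = ξ := abs_of_pos (by linarith [hξ.1])
    simp only [hg]
    rw [phiHat_of_lt hδπ (by linarith [hξ.1]) (by linarith [hξ.2]), habs]
  have hLae : ∀ᵐ ξ : ℝ, ξ ∈ Set.uIoc (-c) (-δ) → g ξ =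
      outer ν σ δ (-ξ) * Complex.exp (Complex.I * (s : ℂ) * (ξ : ℂ)) := by
    filter_upwards [Measure.ae_ne volume (-δ)] with ξ hξ hmem
    rw [Set.uIoc_of_le (by linarith)] at hmem
    exact hL ⟨hmem.1.le, lt_of_le_of_ne hmem.2 hξ⟩
  have iL : IntervalIntegrable g volume (-c) (-δ) := by
    refine IntervalIntegrable.congr_ae (f := fun ξ : ℝ => outer ν σ δ (-ξ) *
      Complex.exp (Complex.I * (s : ℂ) * (ξ : ℂ)))
      (Continuous.intervalIntegrable (by fun_prop) _ _) ?_
    exact (ae_restrict_iff' measurableSet_uIoc).2 (hLae.mono fun ξ h hm => (h hm).symm)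
  have iM : IntervalIntegrable g volume (-δ) δ :=
    IntervalIntegrable.congr (fun ξ hξ => (hM (Set.uIoc_subset_uIcc hξ)).symm)
      (hW.mul (continuous_exp_I_mul_mul s).continuousOn).intervalIntegrable
  have iR : IntervalIntegrable g volume δ c :=
    IntervalIntegrable.congr (fun ξ hξ => (hR (by rwa [Set.uIoc_of_le hδc.le] at hξ)).symm)
      (Continuous.intervalIntegrable (by fun_prop) _ _)
  -- The half-open interval omits `-c`, where vanishing comes from the double zero of `outer`
  -- instead of from the support condition.
  have hzero : ∀ ξ ∉ Set.Ioc (-c) c, g ξ = 0 := by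
    intro ξ hξ
    rcases eq_or_ne ξ (-c) with h | h
    · subst h
      rw [hL ⟨le_rfl, by linarith⟩]
      simp only [neg_neg, hc, outer_right, zero_mul]
    · have : c < |ξ| := by
        by_contra! hle
        rw [abs_le] at hle
        exact hξ ⟨lt_of_le_of_ne hle.1 h.symm, hle.2⟩
      have h1 : ¬ |ξ| ≤ 2 * Real.pi - δ := not_le.2 this
      have h2 : ¬ |ξ| ≤ δ := not_le.2 (hδc.trans this)
      simp only [hg, phiHat, if_neg h1, if_neg h2, zero_mul]
  rw [phi]
  congr 1
  change ∫ ξ, g ξ = _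
  rw [← setIntegral_eq_integral_of_forall_compl_eq_zero hzero,
    ← intervalIntegral.integral_of_le (by linarith),
    ← intervalIntegral.integral_add_adjacent_intervals (iL.trans iM) iR,
    ← intervalIntegral.integral_add_adjacent_intervals iL iM, piecewiseFourier]
  have eL : ∫ ξ in -c..-δ, g ξ =
      ∫ ξ in δ..c, outer ν σ δ ξ * Complex.exp (Complex.I * (-s : ℝ) * ξ) := by
    rw [intervalIntegral.integral_congr_ae hLae,
      ← intervalIntegral.integral_comp_neg]
    refine intervalIntegral.integral_congr fun ξ _ => ?_
    simp only [neg_neg]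
    congr 2
    push_cast
    ring
  have eM : ∫ ξ in -δ..δ, g ξ =
      ∫ ξ in -δ..δ, 1 / W ν σ ξ * Complex.exp (Complex.I * (s : ℂ) * (ξ : ℂ)) :=
    intervalIntegral.integral_congr hM
  have eR : ∫ ξ in δ..c, g ξ =
      ∫ ξ in δ..c, outer ν σ δ ξ * Complex.exp (Complex.I * (s : ℂ) * (ξ : ℂ)) := by
    refine intervalIntegral.integral_congr_ae (Filter.Eventually.of_forall fun ξ hξ => ?_)
    rw [Set.uIoc_of_le hδc.le] at hξ
    exact hR hξ
  rw [eL, eM, eR]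
  ring

/-- With `d = π - δ`, the coefficient of the slope has numerator `2 (2π - δ - ξ) + (ξ - δ) = 4 d -
(ξ - δ)`, largest at `ξ = δ`. -/
theorem norm_outerDeriv2_le {ν : Measure ℝ} [IsProbabilityMeasure ν] {σ δ γ : ℝ} (hσ : 0 ≤ σ)
    (hδπ : δ < Real.pi) (hγ : 0 < γ) (h : γ ≤ ‖W ν σ δ‖) {ξ : ℝ} (h1 : δ ≤ ξ)
    (h2 : ξ ≤ 2 * Real.pi - δ) :
    ‖outerDeriv2 ν σ δ ξ‖ ≤ 5 / (2 * (Real.pi - δ) ^ 2 * γ) + σ / ((Real.pi - δ) * γ ^ 2) := by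
  set d := Real.pi - δ with hd
  have hd0 : 0 < d := sub_pos.2 hδπ
  have hw : ‖1 / W ν σ δ‖ ≤ 1 / γ := by
    rw [norm_div, norm_one]
    exact one_div_le_one_div_of_le hγ h
  have hs : ‖slope ν σ δ‖ ≤ 1 / (d * γ) + σ / 2 / γ ^ 2 := by
    refine (norm_sub_le _ _).trans ?_
    rw [norm_div, norm_one, norm_mul, norm_div, norm_pow, Complex.norm_real,
      Real.norm_of_nonneg hd0.le]
    have := norm_iterW_le ν hσ 1 δ
    rw [pow_one] at this
    gcongr
  have hL : 2 * Real.pi - 2 * δ = 2 * d := by rw [hd]; ring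
  rw [outerDeriv2, hL]
  calc _ ≤ 2 / (2 * d) ^ 2 * (1 / γ + ‖slope ν σ δ‖ * (ξ - δ)) +
        4 * (2 * Real.pi - δ - ξ) / (2 * d) ^ 2 * ‖slope ν σ δ‖ := by
        refine (norm_add_le _ _).trans (add_le_add ?_ ?_)
        · rw [norm_mul, Complex.norm_real, Real.norm_of_nonneg (by positivity)]
          gcongr
          refine (norm_add_le _ _).trans (add_le_add hw ?_)
          rw [norm_mul, Complex.norm_real, Real.norm_of_nonneg (by linarith)]
        · rw [norm_mul, Complex.norm_real, Real.norm_of_nonpos]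
          · refine le_of_eq ?_
            ring
          · exact div_nonpos_of_nonpos_of_nonneg (by linarith) (by positivity)
    _ = 1 / (2 * d ^ 2 * γ) + (2 * (2 * Real.pi - δ - ξ) + (ξ - δ)) / (2 * d ^ 2) *
          ‖slope ν σ δ‖ := by
        field_simp
        ring
    _ ≤ 1 / (2 * d ^ 2 * γ) + (4 * d) / (2 * d ^ 2) * (1 / (d * γ) + σ / 2 / γ ^ 2) := by
        gcongr
        linarith
    _ = _ := by
        field_simp
        ring

/-! ### Size of the periodization in `L²`. -/

/-- Past `δ` two copies overlap, hence the factor `2`; the reflection `ξ ↦ 2π - ξ` keeps both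
arguments in the outer range. -/
theorem norm_fold_le {δ t A B : ℝ} {u v : ℝ → ℂ}
    (hu : ∀ x ∈ Set.Icc (-δ) δ, ‖u x‖ ≤ A) (hv : ∀ x ∈ Set.Icc δ (2 * Real.pi - δ), ‖v x‖ ≤ B)
    {ξ : ℝ} (hξ : ξ ∈ Set.Ioc (-δ) (2 * Real.pi - δ)) :
    ‖fold δ t u v ξ‖ ≤ if ξ ≤ δ then A else 2 * B := by
  unfold fold
  split_ifs with h
  · rw [norm_mul, norm_exp_I_mul_mul, mul_one]
    exact hu ξ ⟨hξ.1.le, h⟩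
  · refine (norm_add_le _ _).trans ?_
    rw [norm_mul, norm_exp_I_mul_mul, mul_one, norm_mul, norm_exp_I_mul_mul, mul_one, two_mul B]
    rw [not_le] at h
    exact add_le_add (hv ξ ⟨h.le, hξ.2⟩)
      (hv (2 * Real.pi - ξ) ⟨by linarith [hξ.2], by linarith⟩)

theorem aestronglyMeasurable_fold {δ t : ℝ} {u v : ℝ → ℂ} (hδ : 0 < δ) (hδπ : δ < Real.pi)
    (hu : ContinuousOn u (Set.Icc (-δ) δ)) (hv : Continuous v) :
    AEStronglyMeasurable (fold δ t u v)
      (volume.restrict (Set.Ioc (-δ) (2 * Real.pi - δ))) := by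
  rw [← Set.Ioc_union_Ioc_eq_Ioc (b := δ) (by linarith) (by linarith),
    aestronglyMeasurable_union_iff]
  constructor
  · have h : AEStronglyMeasurable (fun ξ : ℝ => u ξ * Complex.exp (Complex.I * t * ξ))
        (volume.restrict (Set.Ioc (-δ) δ)) :=
      ((hu.mono Set.Ioc_subset_Icc_self).mul
        (continuous_exp_I_mul_mul t).continuousOn).aestronglyMeasurable measurableSet_Ioc
    refine h.congr ?_
    filter_upwards [ae_restrict_mem measurableSet_Ioc] with ξ hξ
    simp only [fold, if_pos hξ.2]
  · have h : Continuous (fun ξ : ℝ => v ξ * Complex.exp (Complex.I * t * ξ) +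
        v (2 * Real.pi - ξ) * Complex.exp (Complex.I * t * (ξ - 2 * Real.pi : ℝ))) := by
      fun_prop
    refine h.aestronglyMeasurable.congr ?_
    filter_upwards [ae_restrict_mem measurableSet_Ioc] with ξ hξ
    simp only [fold, if_neg (not_le.2 hξ.1)]

theorem memLp_fold {δ t : ℝ} {u v : ℝ → ℂ} (hδ : 0 < δ) (hδπ : δ < Real.pi)
    (hu : ContinuousOn u (Set.Icc (-δ) δ)) (hv : Continuous v) :
    MemLp (fold δ t u v) 2 (volume.restrict (Set.Ioc (-δ) (2 * Real.pi - δ))) := by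
  obtain ⟨A, hA⟩ := isCompact_Icc.exists_bound_of_continuousOn hu
  obtain ⟨B, hB⟩ := (isCompact_Icc (a := δ) (b := 2 * Real.pi - δ)).exists_bound_of_continuousOn
    hv.continuousOn
  refine MemLp.of_bound (aestronglyMeasurable_fold hδ hδπ hu hv) (max A (2 * B)) ?_
  filter_upwards [ae_restrict_mem measurableSet_Ioc] with ξ hξ
  refine (norm_fold_le hA hB hξ).trans ?_
  split_ifs
  · exact le_max_left _ _
  · exact le_max_right _ _

theorem integral_norm_sq_fold_le {δ t A B : ℝ} {u v : ℝ → ℂ} (hδ : 0 < δ) (hδπ : δ < Real.pi)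
    (hu : ContinuousOn u (Set.Icc (-δ) δ)) (hv : Continuous v)
    (hA : ∀ x ∈ Set.Icc (-δ) δ, ‖u x‖ ≤ A)
    (hB : ∀ x ∈ Set.Icc δ (2 * Real.pi - δ), ‖v x‖ ≤ B) :
    ∫ ξ in -δ..(2 * Real.pi - δ), ‖fold δ t u v ξ‖ ^ 2 ≤
      2 * δ * A ^ 2 + (2 * Real.pi - 2 * δ) * (2 * B) ^ 2 := by
  have hint : IntegrableOn (fun ξ => ‖fold δ t u v ξ‖ ^ 2) (Set.Ioc (-δ) (2 * Real.pi - δ)) :=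
    (memLp_fold hδ hδπ hu hv).integrable_norm_pow (by norm_num)
  have i1 : IntervalIntegrable (fun ξ => ‖fold δ t u v ξ‖ ^ 2) volume (-δ) δ := by
    rw [intervalIntegrable_iff_integrableOn_Ioc_of_le (by linarith)]
    exact hint.mono_set (Set.Ioc_subset_Ioc_right (by linarith))
  have i2 : IntervalIntegrable (fun ξ => ‖fold δ t u v ξ‖ ^ 2) volume δ (2 * Real.pi - δ) := by
    rw [intervalIntegrable_iff_integrableOn_Ioc_of_le (by linarith)]
    exact hint.mono_set (Set.Ioc_subset_Ioc_left (by linarith))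
  rw [← intervalIntegral.integral_add_adjacent_intervals i1 i2]
  refine add_le_add ?_ ?_
  · calc ∫ ξ in -δ..δ, ‖fold δ t u v ξ‖ ^ 2 ≤ ∫ ξ in -δ..δ, A ^ 2 := by
          refine intervalIntegral.integral_mono_on_of_le_Ioo (by linarith) i1 (by simp)
            fun ξ hξ => ?_
          have h := norm_fold_le (t := t) hA hB (ξ := ξ) ⟨hξ.1, by linarith [hξ.2]⟩
          rw [if_pos hξ.2.le] at h
          gcongr
      _ = 2 * δ * A ^ 2 := by
          rw [intervalIntegral.integral_const, smul_eq_mul]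
          ring
  · calc ∫ ξ in δ..(2 * Real.pi - δ), ‖fold δ t u v ξ‖ ^ 2 ≤
          ∫ ξ in δ..(2 * Real.pi - δ), (2 * B) ^ 2 := by
          refine intervalIntegral.integral_mono_on_of_le_Ioo (by linarith) i2 (by simp)
            fun ξ hξ => ?_
          have h := norm_fold_le (t := t) hA hB (ξ := ξ) ⟨by linarith [hξ.1], hξ.2.le⟩
          rw [if_neg (not_le.2 hξ.1)] at h
          gcongr
      _ = (2 * Real.pi - 2 * δ) * (2 * B) ^ 2 := by
          rw [intervalIntegral.integral_const, smul_eq_mul]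
          ring

/-! ### Cauchy–Schwarz, average samples and trigonometric polynomials. -/

/-- A quantitative form of the Cauchy–Schwarz inequality. -/
theorem norm_integral_mul_le_of_sq_le {α : Type*} [MeasurableSpace α] {μ : Measure α}
    {F D : α → ℂ} {K : ℝ} (hK : 0 < K) (hF : Integrable (fun x => ‖F x‖ ^ 2) μ)
    (hD : Integrable (fun x => ‖D x‖ ^ 2) μ) (hF1 : ∫ x, ‖F x‖ ^ 2 ∂μ ≤ 1)
    (hDK : ∫ x, ‖D x‖ ^ 2 ∂μ ≤ K ^ 2) : ‖∫ x, F x * D x ∂μ‖ ≤ K := by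
  -- The weights in this pointwise AM–GM make each of the two integrals contribute at most `K / 2`.
  calc ‖∫ x, F x * D x ∂μ‖ ≤ ∫ x, (K / 2 * ‖F x‖ ^ 2 + 1 / (2 * K) * ‖D x‖ ^ 2) ∂μ := by
        refine norm_integral_le_of_norm_le ((hF.const_mul _).add (hD.const_mul _))
          (Filter.Eventually.of_forall fun x => ?_)
        rw [norm_mul]
        have h : K / 2 * ‖F x‖ ^ 2 + 1 / (2 * K) * ‖D x‖ ^ 2 - ‖F x‖ * ‖D x‖ =
            (K * ‖F x‖ - ‖D x‖) ^ 2 / (2 * K) := by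
          field_simp
          ring
        have h2 : 0 ≤ (K * ‖F x‖ - ‖D x‖) ^ 2 / (2 * K) := by positivity
        linarith
    _ = K / 2 * ∫ x, ‖F x‖ ^ 2 ∂μ + 1 / (2 * K) * ∫ x, ‖D x‖ ^ 2 ∂μ := by
        rw [integral_add (hF.const_mul _) (hD.const_mul _), integral_const_mul,
          integral_const_mul]
    _ ≤ K / 2 * 1 + 1 / (2 * K) * K ^ 2 := by gcongr
    _ = K := by
        field_simp
        ring

/-- Average samples in terms of the Fourier representation. -/
theorem averageSample_eq (ν : Measure ℝ) [IsFiniteMeasure ν] (σ : ℝ) {f F : ℝ → ℂ} {c : ℂ}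
    (hF : Integrable F)
    (hf : ∀ t : ℝ, f t = c * ∫ ξ : ℝ, F ξ * Complex.exp (Complex.I * (t : ℂ) * (ξ : ℂ)))
    (j : ℤ) : averageSample ν σ f j =
      c * ∫ ξ : ℝ, F ξ * (W ν σ ξ * Complex.exp (Complex.I * (j : ℝ) * (ξ : ℂ))) := by
  have hint : Integrable (Function.uncurry fun (x ξ : ℝ) =>
      F ξ * Complex.exp (Complex.I * ((j : ℝ) + x : ℝ) * ξ))
      ((ν.restrict (Set.Icc (-(σ / 2)) (σ / 2))).prod volume) := by
    have h1 : Integrable (fun p : ℝ × ℝ => F p.2)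
        ((ν.restrict (Set.Icc (-(σ / 2)) (σ / 2))).prod volume) := hF.comp_snd _
    refine h1.mul_bdd (c := 1) (Continuous.aestronglyMeasurable (by fun_prop)) ?_
    exact Filter.Eventually.of_forall fun p => (norm_exp_I_mul_mul _ _).le
  simp only [averageSample, hf]
  rw [integral_const_mul, integral_integral_swap hint]
  congr 1
  refine integral_congr_ae (Filter.Eventually.of_forall fun ξ => ?_)
  simp only
  rw [integral_const_mul, W, ← integral_mul_const]
  congr 1
  refine integral_congr_ae (Filter.Eventually.of_forall fun x => ?_)
  simp only
  rw [← Complex.exp_add]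
  congr 1
  push_cast
  ring

theorem fourierCoeffOn_exp {δ : ℝ} (hab : -δ < 2 * Real.pi - δ) (j k : ℤ) :
    fourierCoeffOn hab (fun ξ : ℝ => Complex.exp (Complex.I * (j : ℝ) * ξ)) k =
      if k = j then 1 else 0 := by
  have : Fact (0 < 2 * Real.pi - δ - -δ) := ⟨by linarith⟩
  have h := congrFun (fourierCoeff_fourier (T := 2 * Real.pi - δ - -δ) j) k
  rw [Pi.single_apply, fourierCoeff_eq_intervalIntegral _ _ (-δ)] at h
  rw [fourierCoeffOn_eq_integral, ← h]
  have he : -δ + (2 * Real.pi - δ - -δ) = 2 * Real.pi - δ := by ring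
  rw [he]
  congr 1
  refine intervalIntegral.integral_congr fun ξ _ => ?_
  congr 1
  rw [fourier_coe_apply]
  congr 1
  have : ((2 * Real.pi - δ - -δ : ℝ) : ℂ) = 2 * Real.pi := by push_cast; ring
  rw [this]
  have : (Real.pi : ℂ) ≠ 0 := by exact_mod_cast Real.pi_ne_zero
  field_simp
  push_cast
  ring

theorem fourierCoeffOn_sub_sum {δ : ℝ} (hab : -δ < 2 * Real.pi - δ) {g : ℝ → ℂ}
    (hg : IntervalIntegrable g volume (-δ) (2 * Real.pi - δ)) (J : Finset ℤ) (a : ℤ → ℂ) (k : ℤ) :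
    fourierCoeffOn hab
      (fun ξ : ℝ => g ξ - ∑ j ∈ J, a j * Complex.exp (Complex.I * (j : ℝ) * ξ)) k =
      fourierCoeffOn hab g k - if k ∈ J then a k else 0 := by
  have hch : Continuous fun ξ : ℝ => (fourier (-k) (ξ : AddCircle (2 * Real.pi - δ - -δ)) : ℂ) :=
    (map_continuous (fourier (-k))).comp (AddCircle.continuous_mk' _)
  have hsum : ∑ j ∈ J, a j * fourierCoeffOn hab
      (fun ξ : ℝ => Complex.exp (Complex.I * (j : ℝ) * ξ)) k = if k ∈ J then a k else 0 := by
    simp only [fourierCoeffOn_exp, mul_ite, mul_one, mul_zero]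
    exact Finset.sum_ite_eq J k a
  rw [← hsum]
  simp only [fourierCoeffOn_eq_integral, smul_eq_mul, mul_sub, Finset.mul_sum]
  rw [intervalIntegral.integral_sub (hg.continuousOn_mul hch.continuousOn)
    (Continuous.intervalIntegrable (by fun_prop) _ _), intervalIntegral.integral_finsetSum
    (fun j _ => Continuous.intervalIntegrable (by fun_prop) _ _), smul_sub, Finset.smul_sum]
  congr 1
  refine Finset.sum_congr rfl fun j _ => ?_
  rw [Complex.real_smul, Complex.real_smul, mul_left_comm (a j), ← intervalIntegral.integral_const_mul (a j)]
  exact congrArg _ (intervalIntegral.integral_congr fun ξ _ => mul_left_comm (_ : ℂ) _ _)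

/-! ### Parseval and the error estimate for general weights. -/

/-- A trigonometric polynomial whose coefficients reproduce those of `fold δ t u v` up to relative
errors `κ (t - j)²` is close to `fold δ t u v` in `L²`. -/
theorem integral_norm_sq_fold_sub_le {δ t κ : ℝ} {u v u₂ v₂ : ℝ → ℂ} (hδ : 0 < δ)
    (hδπ : δ < Real.pi) (hu : ContinuousOn u (Set.Icc (-δ) δ)) (hv : Continuous v)
    (hu₂ : ContinuousOn u₂ (Set.Icc (-δ) δ)) (hv₂ : Continuous v₂)
    (hpf : ∀ s : ℝ, piecewiseFourier δ u₂ v₂ s = -(s : ℂ) ^ 2 * piecewiseFourier δ u v s)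
    (J : Finset ℤ) (w : ℤ → ℝ)
    (hw : ∀ j : ℤ, |1 - if j ∈ J then w j else 0| ≤ κ * (t - j) ^ 2) :
    (IntervalIntegrable (fun ξ : ℝ => ‖fold δ t u v ξ - ∑ j ∈ J, (w j : ℂ) *
        ((2 * Real.pi : ℂ)⁻¹ * piecewiseFourier δ u v (t - j)) *
          Complex.exp (Complex.I * (j : ℝ) * ξ)‖ ^ 2) volume (-δ) (2 * Real.pi - δ)) ∧
    ∫ ξ in -δ..(2 * Real.pi - δ), ‖fold δ t u v ξ - ∑ j ∈ J, (w j : ℂ) *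
        ((2 * Real.pi : ℂ)⁻¹ * piecewiseFourier δ u v (t - j)) *
          Complex.exp (Complex.I * (j : ℝ) * ξ)‖ ^ 2 ≤
      κ ^ 2 * ∫ ξ in -δ..(2 * Real.pi - δ), ‖fold δ t u₂ v₂ ξ‖ ^ 2 := by
  have hpi := Real.pi_pos
  have hab : -δ < 2 * Real.pi - δ := by linarith
  have hI : Set.uIcc (-δ) δ = Set.Icc (-δ) δ := Set.uIcc_of_le (by linarith)
  have hm := memLp_fold (t := t) hδ hδπ hu hv
  have hm₂ := memLp_fold (t := t) hδ hδπ hu₂ hv₂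
  have hT : MemLp (fun ξ : ℝ => ∑ j ∈ J, (w j : ℂ) *
        ((2 * Real.pi : ℂ)⁻¹ * piecewiseFourier δ u v (t - j)) *
          Complex.exp (Complex.I * (j : ℝ) * ξ)) 2
      (volume.restrict (Set.Ioc (-δ) (2 * Real.pi - δ))) := by
    refine memLp_finsetSum J fun j _ => ?_
    refine MemLp.of_bound (Continuous.aestronglyMeasurable (by fun_prop))
      ‖(w j : ℂ) * ((2 * Real.pi : ℂ)⁻¹ * piecewiseFourier δ u v (t - j))‖
      (Filter.Eventually.of_forall fun ξ => ?_)
    rw [norm_mul _ (Complex.exp _), norm_exp_I_mul_mul, mul_one]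
  have hD := hm.sub hT
  refine ⟨?_, ?_⟩
  · rw [intervalIntegrable_iff_integrableOn_Ioc_of_le hab.le]
    exact hD.integrable_norm_pow (by norm_num)
  have hgi : IntervalIntegrable (fold δ t u v) volume (-δ) (2 * Real.pi - δ) := by
    rw [intervalIntegrable_iff_integrableOn_Ioc_of_le hab.le]
    exact hm.integrable (by norm_num)
  -- Parseval for both functions reduces the claim to comparing coefficients one at a time; the
  -- common factor from the period length cancels.
  have s1 := hasSum_sq_fourierCoeffOn hab hD
  have s2 := (hasSum_sq_fourierCoeffOn hab hm₂).mul_left (κ ^ 2)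
  have hle := hasSum_le (fun k => ?_) s1 s2
  · rw [smul_eq_mul, smul_eq_mul, mul_left_comm] at hle
    exact le_of_mul_le_mul_left hle (inv_pos.2 (by linarith))
  · have hk := fourierCoeffOn_sub_sum hab hgi J (fun j => (w j : ℂ) *
        ((2 * Real.pi : ℂ)⁻¹ * piecewiseFourier δ u v (t - j))) k
    have hk' : fourierCoeffOn hab (fold δ t u v - fun ξ : ℝ => ∑ j ∈ J, (w j : ℂ) *
        ((2 * Real.pi : ℂ)⁻¹ * piecewiseFourier δ u v (t - j)) *
          Complex.exp (Complex.I * (j : ℝ) * ξ)) k =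
        ((1 - if k ∈ J then w k else 0 : ℝ) : ℂ) *
          ((2 * Real.pi : ℂ)⁻¹ * piecewiseFourier δ u v (t - k)) := by
      refine hk.trans ?_
      rw [fourierCoeffOn_fold hδ hδπ hab (hI ▸ hu) hv]
      split_ifs <;> push_cast <;> ring
    rw [hk', fourierCoeffOn_fold hδ hδπ hab (hI ▸ hu₂) hv₂, hpf]
    rw [norm_mul, Complex.norm_real, Real.norm_eq_abs, mul_pow]
    have h1 : ‖(2 * Real.pi : ℂ)⁻¹ * (-((t - k : ℝ) : ℂ) ^ 2 *
        piecewiseFourier δ u v (t - k))‖ =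
        (t - k) ^ 2 * ‖(2 * Real.pi : ℂ)⁻¹ * piecewiseFourier δ u v (t - k)‖ := by
      rw [mul_left_comm, norm_mul, norm_neg, norm_pow, Complex.norm_real, Real.norm_eq_abs, sq_abs]
    rw [h1, mul_pow ((t - k : ℝ) ^ 2), ← mul_assoc (κ ^ 2), ← mul_pow κ]
    exact mul_le_mul_of_nonneg_right (pow_le_pow_left₀ (abs_nonneg _) (hw k) 2) (sq_nonneg _)

/-- The error of a weighted average sampling series with weights `1 - O((t - j)²)`. -/
theorem norm_sub_weighted_series_le {ν : Measure ℝ} [IsProbabilityMeasure ν] {σ δ γ t κ : ℝ}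
    (hδ : 0 < δ) (hδπ : δ < Real.pi) (hσ : 0 ≤ σ) (hγ : 0 < γ) (hγ1 : γ ≤ 1)
    (hW : ∀ ξ : ℝ, |ξ| ≤ δ → γ ≤ ‖W ν σ ξ‖) (hν : ν.map (fun x => -x) = ν) (hκ : 0 < κ)
    {f : ℝ → ℂ} (hf : f ∈ PaleyWiener δ) (hf1 : eLpNorm f 2 volume ≤ 1)
    (J : Finset ℤ) (w : ℤ → ℝ)
    (hw : ∀ j : ℤ, |1 - if j ∈ J then w j else 0| ≤ κ * (t - j) ^ 2) :
    ‖f t - ((Real.sqrt (2 * Real.pi))⁻¹ : ℂ) *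
      ∑ j ∈ J, averageSample ν σ f j * phi ν σ δ (t - j) * (w j : ℂ)‖ ≤
    κ * (Real.sqrt δ * (σ ^ 2 / γ ^ 3) +
      2 * (5 / (2 * (Real.pi - δ) ^ 2 * γ) + σ / ((Real.pi - δ) * γ ^ 2))) := by
  obtain ⟨F, hFm, hF0, hF1, hFf⟩ := PaleyWiener.exists_fourier_integral hf hf1
  have hpi := Real.pi_pos
  have hd : 0 < Real.pi - δ := by linarith
  have hI : Set.uIcc (-δ) δ = Set.Icc (-δ) δ := Set.uIcc_of_le (by linarith)
  set A := σ ^ 2 / γ ^ 3 with hA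
  set B := 5 / (2 * (Real.pi - δ) ^ 2 * γ) + σ / ((Real.pi - δ) * γ ^ 2) with hB
  have hA0 : 0 ≤ A := by positivity
  have hB0 : 0 < B := by positivity
  have hW0 : ∀ ξ ∈ Set.Icc (-δ) δ, W ν σ ξ ≠ 0 := fun ξ hξ h => by
    have := hW ξ (abs_le.2 hξ)
    rw [h, norm_zero] at this
    linarith
  have hWδ := hW δ (abs_of_pos hδ).le
  have hWc := continuous_W ν σ
  have hu : ContinuousOn (fun ξ => 1 / W ν σ ξ) (Set.Icc (-δ) δ) :=
    continuousOn_const.div hWc.continuousOn hW0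
  have hu₂ : ContinuousOn (invWDeriv2 ν σ) (Set.Icc (-δ) δ) := by
    have h1 := continuous_iterW ν σ 1
    have h2 := continuous_iterW ν σ 2
    exact (ContinuousOn.div (by fun_prop) (by fun_prop) fun ξ hξ => pow_ne_zero 3 (hW0 ξ hξ)).sub
      (ContinuousOn.div (by fun_prop) (by fun_prop) fun ξ hξ => pow_ne_zero 2 (hW0 ξ hξ))
  have hv := continuous_outer ν σ δ
  have hv₂ := continuous_outerDeriv2 ν σ δ
  have hWneg : W ν σ (-δ) = W ν σ δ := by
    simpa [iterW_zero] using iterW_neg hν σ 0 δ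
  have hW1neg : iterW ν σ 1 (-δ) = -iterW ν σ 1 δ := by
    simpa using iterW_neg hν σ 1 δ
  have hpf : ∀ s : ℝ, piecewiseFourier δ (invWDeriv2 ν σ) (outerDeriv2 ν σ δ) s =
      -(s : ℂ) ^ 2 * piecewiseFourier δ (fun ξ => 1 / W ν σ ξ) (outer ν σ δ) s := fun s =>
    piecewiseFourier_deriv2 (u₁ := fun ξ => -(iterW ν σ 1 ξ / W ν σ ξ ^ 2))
      (fun x hx => hasDerivAt_inv_W ν (hW0 x (hI ▸ hx)))
      (fun x hx => hasDerivAt_deriv_inv_W ν (hW0 x (hI ▸ hx))) (hI.symm ▸ hu₂)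
      (hasDerivAt_outer ν σ δ) (hasDerivAt_outerDeriv ν σ δ) hv₂
      (by simp only [hWneg]) (by simp only [hWneg, hW1neg, neg_div])
      (outer_left hδπ) (outerDeriv_left hδπ) (outer_right ν σ δ) (outerDeriv_right ν σ δ)
  obtain ⟨hDi, hDle⟩ := integral_norm_sq_fold_sub_le hδ hδπ hu hv hu₂ hv₂ hpf J w hw
  set D : ℝ → ℂ := fun ξ : ℝ => fold δ t (fun ξ => 1 / W ν σ ξ) (outer ν σ δ) ξ -
    ∑ j ∈ J, (w j : ℂ) * ((2 * Real.pi : ℂ)⁻¹ *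
      piecewiseFourier δ (fun ξ => 1 / W ν σ ξ) (outer ν σ δ) (t - j)) *
        Complex.exp (Complex.I * (j : ℝ) * ξ) with hDdef
  set c := Real.sqrt (2 * Real.pi) with hc
  have hc0 : 0 < c := Real.sqrt_pos.2 (by positivity)
  have hc2 : c ^ 2 = 2 * Real.pi := Real.sq_sqrt (by positivity)
  -- The factor `c = √(2π)` is cancelled by the prefactor of the inversion formula.
  set K := c * (κ * (Real.sqrt δ * A + 2 * B)) with hK
  have hK0 : 0 < K := by positivity
  have hDi' : IntegrableOn (fun ξ => ‖D ξ‖ ^ 2) (Set.Ioc (-δ) (2 * Real.pi - δ)) := by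
    rwa [intervalIntegrable_iff_integrableOn_Ioc_of_le (by linarith)] at hDi
  have hsub : Set.Ioc (-δ) δ ⊆ Set.Ioc (-δ) (2 * Real.pi - δ) :=
    Set.Ioc_subset_Ioc_right (by linarith)
  -- Only `[-δ, δ]` matters for the pairing, but Parseval needs a full period, so the integral is
  -- enlarged first.
  have hDK : ∫ ξ in Set.Ioc (-δ) δ, ‖D ξ‖ ^ 2 ≤ K ^ 2 := by
    calc ∫ ξ in Set.Ioc (-δ) δ, ‖D ξ‖ ^ 2
        ≤ ∫ ξ in Set.Ioc (-δ) (2 * Real.pi - δ), ‖D ξ‖ ^ 2 :=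
          setIntegral_mono_set hDi' (Filter.Eventually.of_forall fun ξ => by positivity)
            hsub.eventuallyLE
      _ = ∫ ξ in -δ..(2 * Real.pi - δ), ‖D ξ‖ ^ 2 := by
          rw [intervalIntegral.integral_of_le (by linarith)]
      _ ≤ κ ^ 2 * (2 * δ * A ^ 2 + (2 * Real.pi - 2 * δ) * (2 * B) ^ 2) := by
          refine hDle.trans ?_
          gcongr
          exact integral_norm_sq_fold_le hδ hδπ hu₂ hv₂
            (fun ξ hξ => norm_invWDeriv2_le ν hσ hγ hγ1 (hW ξ (abs_le.2 hξ)))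
            (fun ξ hξ => norm_outerDeriv2_le hσ hδπ hγ hWδ hξ.1 hξ.2)
      _ ≤ κ ^ 2 * (2 * Real.pi * (Real.sqrt δ * A + 2 * B) ^ 2) := by
          gcongr
          have h1 : 1 ≤ Real.pi := by linarith [Real.pi_gt_three]
          have h2 : 0 ≤ (Real.pi - 1) * (δ * A ^ 2) := mul_nonneg (by linarith) (by positivity)
          have h3 : 0 ≤ δ * (2 * B) ^ 2 := by positivity
          have h4 : 0 ≤ Real.pi * (Real.sqrt δ * A * (2 * B)) := by positivity
          have h5 := Real.sq_sqrt hδ.le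
          linear_combination 2 * h2 + 2 * h3 + 4 * h4 + (2 * Real.pi * A ^ 2) * h5.ge
      _ = K ^ 2 := by
          rw [hK, mul_pow c, hc2]
          ring
  have hFsq : Integrable (fun ξ => ‖F ξ‖ ^ 2) := hFm.integrable_norm_pow (by norm_num)
  have hFint : Integrable F := by
    have h1 : IntegrableOn F (Set.Icc (-δ) δ) := (hFm.restrict _).integrable (by norm_num)
    exact (integrableOn_iff_integrable_of_support_subset
      fun ξ hξ => by_contra fun h => hξ (hF0 ξ h)).1 h1
  have hW1 : ∀ ξ, ‖W ν σ ξ‖ ≤ 1 := fun ξ => by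
    simpa [iterW_zero] using norm_iterW_le ν hσ 0 ξ
  have hFWsq : ∀ ξ, ‖F ξ * W ν σ ξ‖ ^ 2 ≤ ‖F ξ‖ ^ 2 := fun ξ => by
    rw [norm_mul]
    exact pow_le_pow_left₀ (by positivity) (mul_le_of_le_one_right (norm_nonneg _) (hW1 ξ)) 2
  have hFWi : Integrable (fun ξ => ‖F ξ * W ν σ ξ‖ ^ 2) :=
    hFsq.mono' ((hFm.1.mul hWc.aestronglyMeasurable).norm.pow 2)
      (Filter.Eventually.of_forall fun ξ => by
        rw [Real.norm_of_nonneg (by positivity)]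
        exact hFWsq ξ)
  have hFW1 : ∫ ξ in Set.Ioc (-δ) δ, ‖F ξ * W ν σ ξ‖ ^ 2 ≤ 1 :=
    (setIntegral_le_integral hFWi (Filter.Eventually.of_forall fun ξ => by positivity)).trans
      ((integral_mono hFWi hFsq hFWsq).trans hF1)
  have hmain : f t - ((c⁻¹ : ℝ) : ℂ) *
      ∑ j ∈ J, averageSample ν σ f j * phi ν σ δ (t - j) * (w j : ℂ) =
      ((c⁻¹ : ℝ) : ℂ) * ∫ ξ in Set.Ioc (-δ) δ, F ξ * W ν σ ξ * D ξ := by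
    have hset : ∀ G : ℝ → ℂ, ∫ ξ, F ξ * G ξ = ∫ ξ in Set.Ioc (-δ) δ, F ξ * G ξ := fun G => by
      rw [← integral_Icc_eq_integral_Ioc]
      exact (setIntegral_eq_integral_of_forall_compl_eq_zero fun ξ hξ => by
        rw [hF0 ξ hξ, zero_mul]).symm
    have hterm : ∀ j : ℤ, averageSample ν σ f j * phi ν σ δ (t - j) * (w j : ℂ) =
        ∫ ξ in Set.Ioc (-δ) δ, F ξ * W ν σ ξ * ((w j : ℂ) * ((2 * Real.pi : ℂ)⁻¹ *
          piecewiseFourier δ (fun ξ => 1 / W ν σ ξ) (outer ν σ δ) (t - j)) *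
            Complex.exp (Complex.I * (j : ℝ) * ξ)) := fun j => by
      rw [averageSample_eq ν σ hFint hFf, hset,
        phi_eq_piecewiseFourier hδ hδπ (hI.symm ▸ hu)]
      have hcc : (2 * Real.pi : ℂ)⁻¹ = (c : ℂ)⁻¹ * (c : ℂ)⁻¹ := by
        rw [← mul_inv, ← sq, ← Complex.ofReal_pow, hc2]
        push_cast
        rfl
      rw [hcc]
      have hr : ∀ ξ : ℝ, F ξ * W ν σ ξ * ((w j : ℂ) * ((c : ℂ)⁻¹ * (c : ℂ)⁻¹ *
          piecewiseFourier δ (fun ξ => 1 / W ν σ ξ) (outer ν σ δ) (t - j)) *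
            Complex.exp (Complex.I * (j : ℝ) * ξ)) =
          ((w j : ℂ) * ((c : ℂ)⁻¹ * (c : ℂ)⁻¹ *
          piecewiseFourier δ (fun ξ => 1 / W ν σ ξ) (outer ν σ δ) (t - j))) *
          (F ξ * (W ν σ ξ * Complex.exp (Complex.I * (j : ℝ) * ξ))) := fun ξ => by ring
      simp only [hr]
      rw [integral_const_mul]
      ring
    have hexp : ∀ s : ℝ, IntegrableOn (fun ξ : ℝ => F ξ * Complex.exp (Complex.I * s * ξ))
        (Set.Ioc (-δ) δ) := fun s =>
      (hFint.mul_bdd (c := 1) (continuous_exp_I_mul_mul s).aestronglyMeasurable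
        (Filter.Eventually.of_forall fun ξ => (norm_exp_I_mul_mul s ξ).le)).integrableOn
    have hFW : Integrable (fun ξ => F ξ * W ν σ ξ) :=
      hFint.mul_bdd (c := 1) hWc.aestronglyMeasurable (Filter.Eventually.of_forall hW1)
    have hFWexp : ∀ j ∈ J, IntegrableOn (fun ξ : ℝ => F ξ * W ν σ ξ * ((w j : ℂ) *
        ((2 * Real.pi : ℂ)⁻¹ *
          piecewiseFourier δ (fun ξ => 1 / W ν σ ξ) (outer ν σ δ) (t - j)) *
            Complex.exp (Complex.I * (j : ℝ) * ξ))) (Set.Ioc (-δ) δ) := fun j _ =>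
      (hFW.mul_bdd (c := ‖(w j : ℂ) * ((2 * Real.pi : ℂ)⁻¹ *
          piecewiseFourier δ (fun ξ => 1 / W ν σ ξ) (outer ν σ δ) (t - j))‖)
        (Continuous.aestronglyMeasurable (by fun_prop))
        (Filter.Eventually.of_forall fun ξ => by
          rw [norm_mul _ (Complex.exp _), norm_exp_I_mul_mul, mul_one])).integrableOn
    rw [Finset.sum_congr rfl fun j _ => hterm j, ← integral_finsetSum J hFWexp, hFf t, hset,
      Complex.ofReal_inv, ← mul_sub, ← integral_sub (hexp t) (integrable_finsetSum J hFWexp)]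
    congr 1
    -- Here `fold` is `e^{itξ} / W(ξ)`, and its denominator cancels the `W` produced by averaging.
    refine setIntegral_congr_fun measurableSet_Ioc fun ξ hξ => ?_
    simp only [hDdef, fold, if_pos hξ.2]
    rw [mul_sub, Finset.mul_sum]
    congr 1
    have := hW0 ξ (Set.Ioc_subset_Icc_self hξ)
    field_simp
  rw [← Complex.ofReal_inv, hmain, norm_mul, Complex.norm_real,
    Real.norm_of_nonneg (inv_nonneg.2 hc0.le)]
  have hfin := norm_integral_mul_le_of_sq_le hK0 hFWi.integrableOn (hDi'.mono_set hsub) hFW1 hDK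
  calc c⁻¹ * ‖∫ ξ in Set.Ioc (-δ) δ, F ξ * W ν σ ξ * D ξ‖ ≤ c⁻¹ * K := by gcongr
    _ = _ := by rw [hK, inv_mul_cancel_left₀ hc0.ne']

/-! ### Gaussian weights, the constant and the conclusion. -/

/-- Inside the range `1 - e^{-x} ≤ x` gives the bound, with a factor `1 / 2` to spare. Outside it
the left side is `1`, and `(t - j)² ≥ n² ≥ n^{5/3}`. -/
theorem abs_one_sub_gaussian_weight_le {n : ℕ} (hn : 1 ≤ n) {t : ℝ} (ht : t ∈ Set.Ioo (0 : ℝ) 1)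
    (j : ℤ) :
    |1 - if j ∈ Finset.Ioc (-(n : ℤ)) (n : ℤ) then
      Real.exp (-(t - (j : ℝ)) ^ 2 / (2 * ((n : ℝ) ^ (5 / 6 : ℝ)) ^ 2)) else 0| ≤
      (n : ℝ) ^ (-(5 / 3) : ℝ) * (t - j) ^ 2 := by
  have hn1 : (1 : ℝ) ≤ n := by exact_mod_cast hn
  have hn0 : (0 : ℝ) < n := by linarith
  have hr : ((n : ℝ) ^ (5 / 6 : ℝ)) ^ 2 = (n : ℝ) ^ (5 / 3 : ℝ) := by
    rw [← Real.rpow_natCast, ← Real.rpow_mul hn0.le]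
    norm_num
  have hr0 : 0 < (n : ℝ) ^ (5 / 3 : ℝ) := Real.rpow_pos_of_pos hn0 _
  rw [hr, Real.rpow_neg hn0.le]
  split_ifs with h
  · have hle : -(t - (j : ℝ)) ^ 2 / (2 * (n : ℝ) ^ (5 / 3 : ℝ)) ≤ 0 :=
      div_nonpos_of_nonpos_of_nonneg (by nlinarith [sq_nonneg (t - (j : ℝ))]) (by positivity)
    rw [abs_of_nonneg (by linarith [Real.exp_le_one_iff.2 hle])]
    have h1 := Real.add_one_le_exp (-(t - (j : ℝ)) ^ 2 / (2 * (n : ℝ) ^ (5 / 3 : ℝ)))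
    have h2 : -(t - (j : ℝ)) ^ 2 / (2 * (n : ℝ) ^ (5 / 3 : ℝ)) =
        -(1 / 2 * (((n : ℝ) ^ (5 / 3 : ℝ))⁻¹ * (t - j) ^ 2)) := by
      field_simp
    have h3 : 0 ≤ ((n : ℝ) ^ (5 / 3 : ℝ))⁻¹ * (t - j) ^ 2 := by positivity
    rw [h2] at h1 ⊢
    linarith
  · rw [sub_zero, abs_one]
    -- The asymmetric range `-n < j ≤ n` fits `0 < t < 1`: the nearest omitted indices are `-n` and
    -- `n + 1`, both at distance more than `n`.
    have hsq : (n : ℝ) ^ 2 ≤ (t - j) ^ 2 := by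
      rw [Finset.mem_Ioc, not_and_or, not_lt, not_le] at h
      rcases h with h | h
      · have : (j : ℝ) ≤ -n := by exact_mod_cast h
        nlinarith [ht.1]
      · have : (n : ℝ) + 1 ≤ j := by exact_mod_cast h
        nlinarith [ht.2]
    have hp : (n : ℝ) ^ (5 / 3 : ℝ) ≤ (n : ℝ) ^ 2 := by
      rw [← Real.rpow_natCast (n : ℝ) 2]
      exact Real.rpow_le_rpow_of_exponent_le hn1 (by norm_num)
    rw [inv_mul_eq_div, le_div_iff₀ hr0, one_mul]
    exact hp.trans hsq

theorem le_errorConstant {δ σ γ : ℝ} (hδ : 0 < δ) (hδπ : δ < Real.pi) (hσ : 0 < σ)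
    (hγ : 0 < γ) :
    Real.sqrt δ * (σ ^ 2 / γ ^ 3) +
      2 * (5 / (2 * (Real.pi - δ) ^ 2 * γ) + σ / ((Real.pi - δ) * γ ^ 2)) ≤
    errorConstant δ σ γ := by
  have hpi := Real.pi_pos
  have hd : 0 < Real.pi - δ := by linarith
  -- The proved constant uses up `2` of the `16` and `5` of the `32`, leaving a sum of nonnegative
  -- terms.
  have key : errorConstant δ σ γ - (Real.sqrt δ * (σ ^ 2 / γ ^ 3) +
      2 * (5 / (2 * (Real.pi - δ) ^ 2 * γ) + σ / ((Real.pi - δ) * γ ^ 2))) =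
      2 * δ * σ ^ 2 / γ ^ 3 + (4 * σ * Real.sqrt δ / (Real.pi - δ) ^ 2 + 14 * σ / (Real.pi - δ)
        + Real.pi * σ * Real.sqrt δ) * (1 / γ ^ 2)
      + (8 * Real.sqrt δ / (Real.pi - δ) ^ 2 + 27 / (Real.pi - δ) + 10 * Real.sqrt δ)
        * (1 / ((Real.pi - δ) * γ)) := by
    unfold errorConstant
    field_simp
    ring
  have : 0 ≤ errorConstant δ σ γ - (Real.sqrt δ * (σ ^ 2 / γ ^ 3) +
      2 * (5 / (2 * (Real.pi - δ) ^ 2 * γ) + σ / ((Real.pi - δ) * γ ^ 2))) := by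
    rw [key]
    positivity
  linarith

end AverageSampling

theorem theorem4 (δ σ : ℝ) (hδ : 0 < δ) (hδπ : δ < Real.pi)
    (hσ : 0 < σ) (hσδ : σ < Real.pi / δ)
    (ν : Measure ℝ) [IsProbabilityMeasure ν]
    (hνsupp : ν (Set.Icc (-(σ / 2)) (σ / 2))ᶜ = 0)
    (hνsymm : ν.map (fun x => -x) = ν)
    (n : ℕ) (hn : 2 ≤ n) :
    (⨆ f ∈ {f : ℝ → ℂ | f ∈ AverageSampling.PaleyWiener δ ∧ eLpNorm f 2 volume ≤ 1},
      eLpNorm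
        (fun t => f t - AverageSampling.gaussianSeries ν σ δ n ((n : ℝ) ^ (5 / 6 : ℝ)) f t)
        ∞ (volume.restrict (Set.Ioo (0 : ℝ) 1)))
    ≤ ENNReal.ofReal
        (AverageSampling.errorConstant δ σ (Real.cos (σ * δ / 2)) * (n : ℝ) ^ (-(5 / 3) : ℝ)) := by
  have hσδ' : σ * δ < Real.pi := (lt_div_iff₀ hδ).1 hσδ
  have hγ : 0 < Real.cos (σ * δ / 2) :=
    Real.cos_pos_of_mem_Ioo ⟨by have := mul_pos hσ hδ; linarith [Real.pi_pos], by linarith⟩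
  have hκ : 0 < (n : ℝ) ^ (-(5 / 3) : ℝ) :=
    Real.rpow_pos_of_pos (by exact_mod_cast (by omega : 0 < n)) _
  refine iSup₂_le fun f hf => ?_
  rw [eLpNorm_exponent_top]
  refine eLpNormEssSup_le_of_ae_bound ?_
  filter_upwards [ae_restrict_mem measurableSet_Ioo] with t ht
  refine (AverageSampling.norm_sub_weighted_series_le hδ hδπ hσ.le hγ (Real.cos_le_one _)
    (fun ξ hξ => AverageSampling.cos_le_norm_W hσ.le hνsupp hσδ'.le hξ) hνsymm hκ hf.1 hf.2 _ _
    (AverageSampling.abs_one_sub_gaussian_weight_le (by omega) ht)).trans ?_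
  rw [mul_comm]
  exact mul_le_mul_of_nonneg_right (AverageSampling.le_errorConstant hδ hδπ hσ hγ) hκ.le
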